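/- The Laguerre--P\'olya class $LP$ consists of all entire functions of the form $$F(z)=Ce^{-\gamma z^2+bz}z^{\kappa}\prod_{k}\Bigl(1-\frac{z}{a_k}\Bigr)e^{z/a_k},$$ where $\gamma\ge 0$, $\kappa\in\mathbb{N}_0$, $b,C\in\mathbb{R}$, and $(a_k)$ is a finite (possibly empty) or infinite sequence of nonzero real numbers with $\sum_k a_k^{-2}<\infty$. Let $a>0$, and let $t_a(x)=(x^2+a^2)^{-1}$ for $x\ge 0$ and $t_a(x)=0$ for $x<0$. Let $F\in LP$ be even, with a zero of order exactly two at the origin, and let $\tau>0$ be such that $F(\tau)=0$ and $F(x)>0$ for $0<x<\tau$. Assume that $F(ia)<0$. Define $$g(t)=\frac{1}{2\pi i}\int_{\tau/2-i\infty}^{\tau/2+i\infty}\frac{e^{st}}{F(s)}\,ds,\qquad h_a(w)=-\int_{-\infty}^0 g(\lambda+w)\sin(a\lambda)\,d\lambda\qquad(t,w\in\mathbb{R}),$$ $$A_1(F,a,z)=\frac{F(z)}{a}\int_{-\infty}^0 h_a(w)e^{-zw}\,dw\quad(\Re z<\tau),$$ $$A_2(F,a,z)=\frac{1}{z^2+a^2}-\frac{F(z)}{a}\int_0^\infty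 h_a(w)e^{-zw}\,dw\quad(\Re z>0).$$ Then all these integrals converge absolutely, $g$ is differentiable on $\mathbb{R}$, and $A_1(F,a,z)=A_2(F,a,z)$ for $0<\Re z<\tau$. Let $A(F,a,\cdot)$ be the common extension of $A_1(F,a,\cdot)$ and $A_2(F,a,\cdot)$ to $\mathbb{C}$, and put $$M^+(F,a,z)=A(F,a,z)+\frac{h_a(0)}{a}\,\frac{F(z)}{z}+\frac{2g'(0)}{a^2}\,\frac{F(z)}{z^2},$$ where $F(z)/z$ and $F(z)/z^2$ are extended continuously to $z=0$. Then $M^+(F,a,\cdot)$ is entire, and $$F(x)\bigl(M^+(F,a,x)-t_a(x)\bigr)\ge 0\qquad\text{for all real }x.$$ -/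

import Mathlib

open scoped ComplexOrder

namespace LPInterp

/-- The Laguerre-Polya class: the functions
`F z = C e^{-γ z² + b z} z^κ ∏ₖ (1 - z / aₖ) e^{z / aₖ}`
with `γ ≥ 0`, `κ ∈ ℕ`, real `C`, `b` and `aₖ ≠ 0`, and `∑ₖ 1 / aₖ² < ∞`.
The product may be finite or empty. We write `r k = 1 / aₖ`; an index with `r k = 0` contributes
the factor `1`, so finite products are those with `r k = 0` for all large `k`. -/
def LaguerrePolya (F : ℂ → ℂ) : Prop :=
  ∃ (C γ b : ℝ) (κ : ℕ) (r : ℕ → ℝ) (P : ℂ → ℂ),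
    0 ≤ γ ∧ Summable (fun k => r k ^ 2) ∧
    (∀ z : ℂ, HasProd (fun k => (1 - (r k : ℂ) * z) * Complex.exp ((r k : ℂ) * z)) (P z)) ∧
    ∀ z : ℂ, F z = (C : ℂ) * Complex.exp (-(γ : ℂ) * z ^ 2 + (b : ℂ) * z) * z ^ κ * P z

/-- The integrand of the inverse Laplace transform of `1 / F` on the line `Re s = c`,
parametrized by `s = c + i u`. -/
noncomputable def gIntegrand (F : ℂ → ℂ) (c t u : ℝ) : ℂ :=
  Complex.exp (((c : ℂ) + Complex.I * (u : ℂ)) * (t : ℂ)) / F ((c : ℂ) + Complex.I * (u : ℂ))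

/-- `g_c(t) = (2 π i)⁻¹ ∫_{c - i∞}^{c + i∞} e^{s t} / F(s) ds`, written with `s = c + i u`,
`ds = i du`. -/
noncomputable def g (F : ℂ → ℂ) (c t : ℝ) : ℂ :=
  (1 / (2 * (Real.pi : ℂ))) * ∫ u : ℝ, gIntegrand F c t u

/-- `h_a(w) = - ∫_{-∞}^0 g(l + w) sin(a l) dl`, where `g = g_{τ/2}`. -/
noncomputable def h (F : ℂ → ℂ) (τ a w : ℝ) : ℂ :=
  -∫ l in Set.Iic (0 : ℝ), g F (τ / 2) (l + w) * (Real.sin (a * l) : ℂ)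

/-- `A₁(z) = (F(z) / a) ∫_{-∞}^0 h_a(w) e^{-z w} dw`, used for `Re z < τ`. -/
noncomputable def A₁ (F : ℂ → ℂ) (τ a : ℝ) (z : ℂ) : ℂ :=
  F z / (a : ℂ) * ∫ w in Set.Iic (0 : ℝ), h F τ a w * Complex.exp (-z * (w : ℂ))

/-- `A₂(z) = 1 / (z² + a²) - (F(z) / a) ∫_0^∞ h_a(w) e^{-z w} dw`, used for `Re z > 0`. -/
noncomputable def A₂ (F : ℂ → ℂ) (τ a : ℝ) (z : ℂ) : ℂ :=
  1 / (z ^ 2 + (a : ℂ) ^ 2) -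
    F z / (a : ℂ) * ∫ w in Set.Ici (0 : ℝ), h F τ a w * Complex.exp (-z * (w : ℂ))

open Classical in
/-- The function `A(F, a, ·)` on the whole plane, glued from `A₁` and `A₂`. -/
noncomputable def A (F : ℂ → ℂ) (τ a : ℝ) (z : ℂ) : ℂ :=
  if z.re < τ then A₁ F τ a z else A₂ F τ a z

/-- `M⁺(F, a, z) = A(F, a, z) + (h_a(0) / a) F(z) / z + (2 g'(0) / a²) F(z) / z²`.
For `F` with a double zero at `0`, the functions `dslope F 0` and `dslope (dslope F 0) 0` are
`F(z) / z` and `F(z) / z²`, with the removable singularity at `0` filled in. -/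
noncomputable def MPlus (F : ℂ → ℂ) (τ a : ℝ) (z : ℂ) : ℂ :=
  A F τ a z + h F τ a 0 / (a : ℂ) * dslope F 0 z +
    2 * deriv (g F (τ / 2)) 0 / (a : ℂ) ^ 2 * dslope (dslope F 0) 0 z

open Classical in
/-- `t_a(x) = 1 / (x² + a²)` for `x ≥ 0`, and `0` for `x < 0`. -/
noncomputable def truncRecip (a x : ℝ) : ℝ :=
  if 0 ≤ x then (x ^ 2 + a ^ 2)⁻¹ else 0

/-- All the objects from which `M⁺(F, a, ·)` is built make sense: the integrals converge
absolutely, `g` is differentiable, and `A₁` and `A₂` agree on the strip where both are defined. -/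
structure WellDefined (F : ℂ → ℂ) (τ a : ℝ) : Prop where
  integrable_g : ∀ t : ℝ, MeasureTheory.Integrable (gIntegrand F (τ / 2) t)
  differentiable_g : Differentiable ℝ (g F (τ / 2))
  integrable_h : ∀ w : ℝ, MeasureTheory.IntegrableOn
    (fun l : ℝ => g F (τ / 2) (l + w) * (Real.sin (a * l) : ℂ)) (Set.Iic 0)
  integrable_A₁ : ∀ z : ℂ, z.re < τ → MeasureTheory.IntegrableOn
    (fun w : ℝ => h F τ a w * Complex.exp (-z * (w : ℂ))) (Set.Iic 0)
  integrable_A₂ : ∀ z : ℂ, 0 < z.re → MeasureTheory.IntegrableOn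
    (fun w : ℝ => h F τ a w * Complex.exp (-z * (w : ℂ))) (Set.Ici 0)
  A₁_eq_A₂ : ∀ z : ℂ, 0 < z.re → z.re < τ → A₁ F τ a z = A₂ F τ a z

end LPInterp

/-! Write `F z = z ^ 2 * E z`. The function `E` is even, belongs to the same class and has no zeros
in `|Re z| < τ`. There `1 / E` is the bilateral Laplace transform of a nonnegative even density `φ`:
a Gaussian factor and the reciprocal of each genus-one factor are transforms of nonnegative
measures, and nonnegativity survives products and limits (`lineInv_inv_nonneg`). The zeros at `±τ`
make `1 / E` decay quadratically on vertical lines, which justifies all integrals and contour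
shifts.

Everything in `M⁺` is then expressed by `φ`. Since `a / (F(s) (s² + a²)) = E(s)⁻¹ · a / (s² (s² +
a²))`, the function `h_a` equals `H(w) = ∫ φ(u) ramp(w - u) du` (`h_eq_ofReal`), and `2 g'(0) = ∫ φ`
by evenness (`two_mul_deriv_g_zero`). Laplace inversion for `h_a` is the identity `A₁ = A₂`.

For `x ≠ 0` the product `F(x) (M⁺(x) - t_a(x))` is `F(x)² / a` times a real bracket. For `x > 0` the
bracket is `H(0)/x + (∫ φ)/(a x²) - ∫_0^∞ H(w) e^{-xw} dw`; for `x < 0` it is `∫_{-∞}^0 H(w) e^{-xw}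
dw` minus the same integral of the affine function `H(0) + (∫ φ) w / a`. Both are integrals against
`φ`, so evenness lets the kernel inequality be checked after averaging over `u` and `-u`. This gives
`symm_kernel_nonneg`, which rests on the inequality `one_sub_exp_add_cos_sub_sin_nonneg`, and
`symm_ramp_sub_le`, which only uses that `ramp` has slope at most `2 / a`. -/

namespace LPInterp

open MeasureTheory Filter Topology Set

/-! ### Inverse Laplace transforms on vertical strips. -/

/-- Inverse bilateral Laplace transform along the line `Re s = c`. -/
noncomputable def lineInv (ψ : ℂ → ℂ) (c t : ℝ) : ℂ :=
  (1 / (2 * (Real.pi : ℂ))) *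
    ∫ u : ℝ, Complex.exp (((c : ℂ) + Complex.I * (u : ℂ)) * (t : ℂ)) * ψ (c + Complex.I * u)

/-- Functions holomorphic on the strip `α < Re s < β` that are `O((1 + (Im s)²)⁻¹)`,
uniformly on closed substrips. -/
structure StripDecay (ψ : ℂ → ℂ) (α β : ℝ) : Prop where
  diff : DifferentiableOn ℂ ψ (Complex.re ⁻¹' Ioo α β)
  decay : ∀ c₁ c₂ : ℝ, α < c₁ → c₁ ≤ c₂ → c₂ < β →
    ∃ B : ℝ, ∀ σ ∈ Icc c₁ c₂, ∀ u : ℝ, ‖ψ (σ + Complex.I * u)‖ ≤ B * (1 + u ^ 2)⁻¹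

lemma line_mem_strip {α β c : ℝ} (hc : c ∈ Ioo α β) (u : ℝ) :
    (c : ℂ) + Complex.I * u ∈ Complex.re ⁻¹' Ioo α β := by
  simpa using hc

lemma norm_exp_line (c t u : ℝ) :
    ‖Complex.exp (((c : ℂ) + Complex.I * (u : ℂ)) * (t : ℂ))‖ = Real.exp (c * t) := by
  rw [Complex.norm_exp]; simp

lemma exp_mul_le_of_abs_lt (c : ℝ) {t t₀ : ℝ} (ht : |t| < |t₀| + 1) :
    Real.exp (c * t) ≤ Real.exp (|c| * (|t₀| + 1)) := by
  refine Real.exp_le_exp.2 ?_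
  calc c * t ≤ |c * t| := le_abs_self _
    _ = |c| * |t| := abs_mul _ _
    _ ≤ _ := by gcongr

namespace StripDecay

variable {ψ χ : ℂ → ℂ} {α β : ℝ}

lemma mono {α' β' : ℝ} (hψ : StripDecay ψ α β) (h1 : α ≤ α') (h2 : β' ≤ β) :
    StripDecay ψ α' β' where
  diff := hψ.diff.mono fun _ hz => ⟨h1.trans_lt hz.1, hz.2.trans_le h2⟩
  decay c₁ c₂ ha hc hb := hψ.decay c₁ c₂ (h1.trans_lt ha) hc (hb.trans_le h2)

lemma mul_bounded (hψ : StripDecay ψ α β) (hχ : DifferentiableOn ℂ χ (Complex.re ⁻¹' Ioo α β))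
    (hb : ∀ c₁ c₂ : ℝ, α < c₁ → c₁ ≤ c₂ → c₂ < β →
      ∃ B : ℝ, ∀ z : ℂ, z.re ∈ Icc c₁ c₂ → ‖χ z‖ ≤ B) :
    StripDecay (fun s => ψ s * χ s) α β where
  diff := hψ.diff.mul hχ
  decay c₁ c₂ h1 h12 h2 := by
    obtain ⟨B, hB⟩ := hψ.decay c₁ c₂ h1 h12 h2
    obtain ⟨D, hD⟩ := hb c₁ c₂ h1 h12 h2
    refine ⟨B * D, fun σ hσ u => ?_⟩
    have e1 := hB σ hσ u
    have e2 := hD (σ + Complex.I * u) (by simpa using hσ)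
    rw [norm_mul, mul_right_comm]
    exact mul_le_mul e1 e2 (norm_nonneg _) ((norm_nonneg _).trans e1)

lemma exp_mul (hψ : StripDecay ψ α β) (t : ℝ) :
    StripDecay (fun s => Complex.exp (s * t) * ψ s) α β := by
  have := hψ.mul_bounded (χ := fun s => Complex.exp (s * t)) (by fun_prop)
    (fun c₁ c₂ _ _ _ => ⟨Real.exp ((|c₁| + |c₂|) * |t|), fun z hz => by
      rw [Complex.norm_exp]
      refine Real.exp_le_exp.2 ?_
      have hz' : |z.re| ≤ |c₁| + |c₂| :=
        abs_le.2 ⟨by linarith [neg_abs_le c₁, abs_nonneg c₂, hz.1],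
          by linarith [le_abs_self c₂, abs_nonneg c₁, hz.2]⟩
      calc (z * t).re = z.re * t := by simp
        _ ≤ |z.re * t| := le_abs_self _
        _ = |z.re| * |t| := abs_mul _ _
        _ ≤ _ := by gcongr⟩)
  simpa only [mul_comm] using this

lemma continuous_line (hψ : StripDecay ψ α β) {c : ℝ} (hc : c ∈ Ioo α β) :
    Continuous fun u : ℝ => ψ (c + Complex.I * u) :=
  hψ.diff.continuousOn.comp_continuous (by fun_prop) (line_mem_strip hc)

lemma integrable_line (hψ : StripDecay ψ α β) {c : ℝ} (hc : c ∈ Ioo α β) :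
    Integrable fun u : ℝ => ψ (c + Complex.I * u) := by
  obtain ⟨B, hB⟩ := hψ.decay c c hc.1 le_rfl hc.2
  refine (integrable_inv_one_add_sq.const_mul B).mono'
    (hψ.continuous_line hc).aestronglyMeasurable (ae_of_all _ fun u => hB c ⟨le_rfl, le_rfl⟩ u)

lemma integrable_exp_line (hψ : StripDecay ψ α β) {c : ℝ} (hc : c ∈ Ioo α β) (t : ℝ) :
    Integrable fun u : ℝ =>
      Complex.exp (((c : ℂ) + Complex.I * (u : ℂ)) * (t : ℂ)) * ψ (c + Complex.I * u) :=
  (hψ.exp_mul t).integrable_line hc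

/-- Shift of the line of integration inside the strip. -/
lemma integral_line_eq (hψ : StripDecay ψ α β) {c₁ c₂ : ℝ} (h1 : α < c₁) (h12 : c₁ ≤ c₂)
    (h2 : c₂ < β) :
    ∫ u : ℝ, ψ (c₁ + Complex.I * u) = ∫ u : ℝ, ψ (c₂ + Complex.I * u) := by
  obtain ⟨B, hB⟩ := hψ.decay c₁ c₂ h1 h12 h2
  have hT : Tendsto (fun T : ℝ => B * (1 + T ^ 2)⁻¹ * |c₂ - c₁|) atTop (𝓝 0) := by
    have : Tendsto (fun T : ℝ => (1 + T ^ 2)⁻¹) atTop (𝓝 0) :=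
      tendsto_inv_atTop_zero.comp
        (tendsto_atTop_add_const_left _ _ (tendsto_pow_atTop two_ne_zero))
    simpa using (this.const_mul B).mul_const |c₂ - c₁|
  have hint : ∀ c ∈ Ioo α β, Tendsto (fun T : ℝ => ∫ u in (-T)..T, ψ (c + Complex.I * u)) atTop
      (𝓝 (∫ u : ℝ, ψ (c + Complex.I * u))) := fun c hc =>
    intervalIntegral_tendsto_integral (hψ.integrable_line hc) tendsto_neg_atTop_atBot tendsto_id
  -- Taking `s = 1` and `s = -1` treats the top and the bottom side of the rectangle at once.
  have hI : ∀ s : ℝ, s ^ 2 = 1 → Tendsto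
      (fun T : ℝ => ∫ x in c₁..c₂, ψ (x + Complex.I * ((s * T : ℝ) : ℂ))) atTop (𝓝 0) := by
    intro s hs
    refine squeeze_zero_norm (fun T => ?_) hT
    refine intervalIntegral.norm_integral_le_of_norm_le_const fun x hx => ?_
    rw [uIoc_of_le h12] at hx
    have := hB x ⟨hx.1.le, hx.2⟩ (s * T)
    rwa [mul_pow, hs, one_mul] at this
  have key : ∀ T : ℝ, Complex.I * (∫ u in (-T)..T, ψ (c₂ + Complex.I * u)) -
      Complex.I * (∫ u in (-T)..T, ψ (c₁ + Complex.I * u)) =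
      (∫ x in c₁..c₂, ψ (x + Complex.I * ((1 * T : ℝ) : ℂ))) -
        ∫ x in c₁..c₂, ψ (x + Complex.I * ((-1 * T : ℝ) : ℂ)) := by
    intro T
    have := Complex.integral_boundary_rect_eq_zero_of_differentiableOn ψ
      (c₁ + Complex.I * ((-1 * T : ℝ) : ℂ)) (c₂ + Complex.I * ((1 * T : ℝ) : ℂ))
      (hψ.diff.mono fun z hz => by
        have hz1 := hz.1
        simp only [mem_preimage, Complex.add_re, Complex.ofReal_re, Complex.mul_re, Complex.I_re,
          Complex.I_im, Complex.ofReal_im, zero_mul, mul_zero, sub_zero, add_zero,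
          uIcc_of_le h12] at hz1
        exact ⟨h1.trans_le hz1.1, hz1.2.trans_lt h2⟩)
    simp only [Complex.add_re, Complex.ofReal_re, Complex.mul_re, Complex.I_re,
          Complex.I_im, Complex.ofReal_im, zero_mul, mul_zero, sub_zero, add_zero, Complex.add_im,
          Complex.mul_im, zero_add, one_mul, smul_eq_mul, neg_mul] at this ⊢
    simp only [mul_comm Complex.I] at this ⊢
    linear_combination this
  have L := ((hint c₂ ⟨h1.trans_le h12, h2⟩).const_mul Complex.I).sub
    ((hint c₁ ⟨h1, h12.trans_lt h2⟩).const_mul Complex.I)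
  simp only [key] at L
  have := tendsto_nhds_unique L ((hI 1 (by norm_num)).sub (hI (-1) (by norm_num)))
  rw [sub_zero, ← mul_sub, mul_eq_zero, sub_eq_zero] at this
  exact (this.resolve_left Complex.I_ne_zero).symm

lemma lineInv_eq (hψ : StripDecay ψ α β) {c₁ c₂ : ℝ} (h1 : c₁ ∈ Ioo α β) (h2 : c₂ ∈ Ioo α β)
    (t : ℝ) : lineInv ψ c₁ t = lineInv ψ c₂ t := by
  rcases le_total c₁ c₂ with h | h
  · exact congrArg _ ((hψ.exp_mul t).integral_line_eq h1.1 h h2.2)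
  · exact congrArg _ ((hψ.exp_mul t).integral_line_eq h2.1 h h1.2).symm

lemma norm_lineInv_le (ψ : ℂ → ℂ) (c t : ℝ) :
    ‖lineInv ψ c t‖ ≤
      (1 / (2 * Real.pi) * ∫ u : ℝ, ‖ψ (c + Complex.I * u)‖) * Real.exp (c * t) := by
  have e : ‖(1 / (2 * (Real.pi : ℂ)))‖ = 1 / (2 * Real.pi) := by
    simp [abs_of_pos Real.pi_pos]
  rw [lineInv, norm_mul, e, mul_assoc, ← integral_mul_const]
  gcongr
  refine (norm_integral_le_integral_norm _).trans (le_of_eq ?_)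
  congr 1; ext u
  rw [norm_mul, norm_exp_line, mul_comm]

/-- The inverse transform is `O(e^{c t})` for every `c` in the strip. -/
lemma exists_bound (hψ : StripDecay ψ α β) {c c' : ℝ} (hc : c ∈ Ioo α β) (hc' : c' ∈ Ioo α β) :
    ∃ K : ℝ, 0 ≤ K ∧ ∀ t, ‖lineInv ψ c t‖ ≤ K * Real.exp (c' * t) :=
  ⟨1 / (2 * Real.pi) * ∫ u : ℝ, ‖ψ (c' + Complex.I * u)‖, by positivity, fun t => by
    rw [hψ.lineInv_eq hc hc']; exact norm_lineInv_le _ _ _⟩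

lemma continuous_lineInv (hψ : StripDecay ψ α β) {c : ℝ} (hc : c ∈ Ioo α β) :
    Continuous (lineInv ψ c) := by
  refine continuous_const.mul (continuous_iff_continuousAt.2 fun t₀ => ?_)
  refine continuousAt_of_dominated
    (bound := fun u => Real.exp (|c| * (|t₀| + 1)) * ‖ψ (c + Complex.I * u)‖)
    (Eventually.of_forall fun t => (hψ.integrable_exp_line hc t).aestronglyMeasurable) ?_
    ((hψ.integrable_line hc).norm.const_mul _) (ae_of_all _ fun u => by fun_prop)
  have : ∀ᶠ t in 𝓝 t₀, |t| < |t₀| + 1 :=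
    continuous_abs.continuousAt.eventually (gt_mem_nhds (lt_add_one _))
  filter_upwards [this] with t ht
  refine ae_of_all _ fun u => ?_
  rw [norm_mul, norm_exp_line]
  exact mul_le_mul_of_nonneg_right (exp_mul_le_of_abs_lt c ht) (norm_nonneg _)

/-- Differentiation of the inverse transform. -/
lemma hasDerivAt_lineInv (hψ : StripDecay ψ α β) (hχ : StripDecay (fun s => s * ψ s) α β)
    {c : ℝ} (hc : c ∈ Ioo α β) (t₀ : ℝ) :
    HasDerivAt (lineInv ψ c) (lineInv (fun s => s * ψ s) c t₀) t₀ := by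
  refine HasDerivAt.const_mul _ ?_
  refine (hasDerivAt_integral_of_dominated_loc_of_deriv_le (𝕜 := ℝ)
    (bound := fun u : ℝ => Real.exp (|c| * (|t₀| + 1)) *
      ‖(fun s : ℂ => s * ψ s) (c + Complex.I * u)‖)
    (F' := fun (t u : ℝ) => Complex.exp (((c : ℂ) + Complex.I * (u : ℂ)) * (t : ℂ)) *
      (((c : ℂ) + Complex.I * u) * ψ (c + Complex.I * u)))
    (F := fun (t u : ℝ) =>
      Complex.exp (((c : ℂ) + Complex.I * (u : ℂ)) * (t : ℂ)) * ψ (c + Complex.I * u))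
    (s := {t | |t| < |t₀| + 1}) ?_
    (Eventually.of_forall fun t => (hψ.integrable_exp_line hc t).aestronglyMeasurable)
    (hψ.integrable_exp_line hc t₀) (hχ.integrable_exp_line hc t₀).aestronglyMeasurable
    ?_ ((hχ.integrable_line hc).norm.const_mul _) ?_).2
  · exact continuous_abs.continuousAt.eventually (gt_mem_nhds (lt_add_one _))
  · refine ae_of_all _ fun u t ht => ?_
    rw [norm_mul, norm_exp_line]
    exact mul_le_mul_of_nonneg_right (exp_mul_le_of_abs_lt c ht) (norm_nonneg _)
  · refine ae_of_all _ fun u t _ => ?_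
    have h1 : HasDerivAt (fun t : ℝ => ((c : ℂ) + Complex.I * u) * (t : ℂ))
        ((c : ℂ) + Complex.I * u) t := by
      simpa using (Complex.ofRealCLM.hasDerivAt (x := t)).const_mul ((c : ℂ) + Complex.I * u)
    simpa only [mul_assoc] using h1.cexp.mul_const (ψ (c + Complex.I * u))

end StripDecay

lemma integrableOn_exp_bound_Ici {f : ℝ → ℂ} (hf : Continuous f) {K c : ℝ}
    (hK : ∀ t, ‖f t‖ ≤ K * Real.exp (c * t)) {z : ℂ} (hz : c < z.re) :
    IntegrableOn (fun w : ℝ => f w * Complex.exp (-z * (w : ℂ))) (Ici 0) := by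
  rw [integrableOn_Ici_iff_integrableOn_Ioi]
  refine Integrable.mono'
    ((integrableOn_exp_mul_Ioi (a := c - z.re) (by linarith) 0).const_mul K)
    (by fun_prop) (ae_of_all _ fun w => ?_)
  rw [norm_mul, Complex.norm_exp]
  calc _ ≤ K * Real.exp (c * w) * Real.exp ((-z * (w : ℂ)).re) := by gcongr; exact hK w
    _ = _ := by rw [mul_assoc, ← Real.exp_add]; congr 2; simp; ring

lemma integrableOn_exp_bound_Iic {f : ℝ → ℂ} (hf : Continuous f) {K c : ℝ}
    (hK : ∀ t, ‖f t‖ ≤ K * Real.exp (c * t)) {z : ℂ} (hz : z.re < c) :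
    IntegrableOn (fun w : ℝ => f w * Complex.exp (-z * (w : ℂ))) (Iic 0) := by
  refine Integrable.mono'
    ((integrableOn_exp_mul_Iic (a := c - z.re) (by linarith) 0).const_mul K)
    (by fun_prop) (ae_of_all _ fun w => ?_)
  rw [norm_mul, Complex.norm_exp]
  calc _ ≤ K * Real.exp (c * w) * Real.exp ((-z * (w : ℂ)).re) := by gcongr; exact hK w
    _ = _ := by rw [mul_assoc, ← Real.exp_add]; congr 2; simp; ring

namespace StripDecay

variable {ψ : ℂ → ℂ} {α β : ℝ}

lemma integrableOn_Ici (hψ : StripDecay ψ α β) {c : ℝ} (hc : c ∈ Ioo α β) {z : ℂ}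
    (hz : α < z.re) :
    IntegrableOn (fun w : ℝ => lineInv ψ c w * Complex.exp (-z * (w : ℂ))) (Ici 0) := by
  have hlt : α < min z.re β := lt_min hz (hc.1.trans hc.2)
  obtain ⟨d, hd1, hd2⟩ := exists_between hlt
  obtain ⟨K, -, hK⟩ := hψ.exists_bound hc ⟨hd1, hd2.trans_le (min_le_right _ _)⟩
  exact integrableOn_exp_bound_Ici (hψ.continuous_lineInv hc) hK
    (hd2.trans_le (min_le_left _ _))

lemma integrableOn_Iic (hψ : StripDecay ψ α β) {c : ℝ} (hc : c ∈ Ioo α β) {z : ℂ}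
    (hz : z.re < β) :
    IntegrableOn (fun w : ℝ => lineInv ψ c w * Complex.exp (-z * (w : ℂ))) (Iic 0) := by
  have hlt : max z.re α < β := max_lt hz (hc.1.trans hc.2)
  obtain ⟨d, hd1, hd2⟩ := exists_between hlt
  obtain ⟨K, -, hK⟩ := hψ.exists_bound hc ⟨(le_max_right _ _).trans_lt hd1, hd2⟩
  exact integrableOn_exp_bound_Iic (hψ.continuous_lineInv hc) hK
    ((le_max_left _ _).trans_lt hd1)

lemma integrable_lineInv_mul_exp (hψ : StripDecay ψ α β) {c : ℝ} (hc : c ∈ Ioo α β) {z : ℂ}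
    (hz1 : α < z.re) (hz2 : z.re < β) :
    Integrable (fun w : ℝ => lineInv ψ c w * Complex.exp (-z * (w : ℂ))) := by
  rw [← integrableOn_univ, ← Iic_union_Ici (a := (0 : ℝ))]
  exact (hψ.integrableOn_Iic hc hz2).union (hψ.integrableOn_Ici hc hz1)

open FourierTransform in
/-- Laplace inversion. -/
lemma integral_lineInv_mul_exp (hψ : StripDecay ψ α β) {c : ℝ} (hc : c ∈ Ioo α β) {z : ℂ}
    (hz1 : α < z.re) (hz2 : z.re < β) :
    ∫ w : ℝ, lineInv ψ c w * Complex.exp (-z * (w : ℂ)) = ψ z := by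
  have hd : z.re ∈ Ioo α β := ⟨hz1, hz2⟩
  have hpi : (2 * Real.pi) ≠ 0 := by positivity
  -- The factor `2 π` matches the normalization `e^{2πivw}` of the Fourier transform; Laplace
  -- inversion on the line through `z` becomes Fourier inversion for `f`.
  set f : ℝ → ℂ := fun v => ψ (z.re + Complex.I * ((2 * Real.pi * v : ℝ) : ℂ)) with hf
  have hfc : Continuous f := (hψ.continuous_line hd).comp (by fun_prop)
  have hfi : Integrable f := (hψ.integrable_line hd).comp_mul_left' hpi
  have hFI : ∀ w : ℝ, 𝓕⁻ f w = lineInv ψ c w * Complex.exp (-z.re * (w : ℂ)) := by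
    intro w
    rw [hψ.lineInv_eq hc hd, lineInv, Real.fourierInv_eq']
    have := Measure.integral_comp_mul_left
      (fun u : ℝ => Complex.exp ((u * w : ℝ) * Complex.I) * ψ (z.re + Complex.I * u)) (2 * Real.pi)
    simp only [smul_eq_mul, hf]
    rw [show (∫ v : ℝ, Complex.exp (↑(2 * Real.pi * inner ℝ v w) * Complex.I) *
        ψ (↑z.re + Complex.I * ↑(2 * Real.pi * v))) = ∫ v : ℝ,
        Complex.exp (((2 * Real.pi * v * w : ℝ) : ℂ) * Complex.I) *
        ψ (↑z.re + Complex.I * ↑(2 * Real.pi * v)) from by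
          congr 1; ext v; congr 4; simp; ring]
    rw [this, mul_assoc, mul_comm (∫ u : ℝ, _) (Complex.exp _), ← integral_const_mul,
      abs_of_pos (by positivity), Complex.real_smul]
    congr 1
    · push_cast; simp
    · congr 1; ext u
      rw [← mul_assoc, ← Complex.exp_add]
      congr 2; push_cast; ring
  -- Integrability on the transform side comes from the freedom to move the line: lines to either
  -- side of `Re z` give exponential decay at `+∞` and at `-∞`.
  have hint : Integrable (𝓕⁻ f) := by
    refine (hψ.integrable_lineInv_mul_exp hc (z := (z.re : ℂ)) (by simpa) (by simpa)).congr ?_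
    exact ae_of_all _ fun w => (hFI w).symm
  have hint' : Integrable (𝓕 f) := by
    have e : 𝓕 f = fun v => 𝓕⁻ f (-v) := by
      ext v; rw [Real.fourierInv_eq_fourier_neg, neg_neg]
    rw [e]; exact hint.comp_neg
  have inv := congrFun (hfc.fourier_fourierInv_eq hfi hint') (z.im / (2 * Real.pi))
  have e1 : f (z.im / (2 * Real.pi)) = ψ z := by
    simp only [hf]; congr 1
    rw [mul_div_cancel₀ _ hpi, mul_comm, Complex.re_add_im]
  rw [e1, Real.fourier_eq'] at inv
  rw [← inv]
  congr 1; ext w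
  rw [hFI, smul_eq_mul, mul_left_comm, ← Complex.exp_add]
  congr 2
  conv_lhs => rw [← Complex.re_add_im z]
  simp only [RCLike.inner_apply, conj_trivial]
  rw [show -2 * Real.pi * (z.im / (2 * Real.pi) * w) = - (z.im * w) by field_simp]
  push_cast; ring

end StripDecay

/-- Superposition of translates of an inverse transform, computed by Fubini. -/
lemma integral_mul_lineInv_sub {ψ χ : ℂ → ℂ} {c : ℝ}
    (hψ : Integrable fun u : ℝ => ψ (c + Complex.I * u))
    {μ : Measure ℝ} [SFinite μ] {κ : ℝ → ℂ} {y : ℝ → ℝ} (hy : Measurable y)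
    (hκ : Integrable (fun v => κ v * Complex.exp (-(c : ℂ) * (y v : ℂ))) μ)
    (hχ : ∀ u : ℝ, χ (c + Complex.I * u) =
      ψ (c + Complex.I * u) * ∫ v, κ v * Complex.exp (-((c : ℂ) + Complex.I * u) * (y v : ℂ)) ∂μ)
    (t : ℝ) :
    ∫ v, κ v * lineInv ψ c (t - y v) ∂μ = lineInv χ c t := by
  have hint : Integrable (fun p : ℝ × ℝ => κ p.1 *
      (Complex.exp (((c : ℂ) + Complex.I * (p.2 : ℂ)) * ((t - y p.1 : ℝ) : ℂ)) *
        ψ (c + Complex.I * p.2))) (μ.prod volume) := by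
    have h1 := (hκ.mul_prod hψ).bdd_mul (c := Real.exp (c * t))
      (f := fun p : ℝ × ℝ => Complex.exp (((c : ℂ) + Complex.I * (p.2 : ℂ)) * (t : ℂ) -
        Complex.I * (p.2 : ℂ) * (y p.1 : ℂ)))
      (Measurable.aestronglyMeasurable (by fun_prop))
      (ae_of_all _ fun p => by rw [Complex.norm_exp]; simp)
    refine h1.congr (ae_of_all _ fun p => ?_)
    simp only
    have : Complex.exp (((c : ℂ) + Complex.I * (p.2 : ℂ)) * ((t - y p.1 : ℝ) : ℂ)) =
      Complex.exp (((c : ℂ) + Complex.I * (p.2 : ℂ)) * (t : ℂ) -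
        Complex.I * (p.2 : ℂ) * (y p.1 : ℂ)) * Complex.exp (-(c : ℂ) * (y p.1 : ℂ)) := by
      rw [← Complex.exp_add]; congr 1; push_cast; ring
    rw [this]; ring
  simp only [lineInv]
  simp_rw [mul_left_comm (κ _), ← integral_const_mul (κ _)]
  rw [integral_const_mul, integral_integral_swap hint]
  congr 2; ext u
  rw [hχ, mul_left_comm, ← integral_const_mul, ← integral_const_mul]
  congr 1; ext v
  have : Complex.exp (((c : ℂ) + Complex.I * (u : ℂ)) * ((t - y v : ℝ) : ℂ)) =
      Complex.exp (((c : ℂ) + Complex.I * (u : ℂ)) * (t : ℂ)) *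
        Complex.exp (-((c : ℂ) + Complex.I * (u : ℂ)) * (y v : ℂ)) := by
    rw [← Complex.exp_add]; congr 1; push_cast; ring
  rw [this]; ring

/-! ### Genus-one factors and canonical products. -/

/-- The elementary factor of genus one with zero `1 / r`. -/
noncomputable def genusOneFactor (r : ℝ) (z : ℂ) : ℂ :=
  (1 - (r : ℂ) * z) * Complex.exp ((r : ℂ) * z)

/-- The exponential cancels the linear term of `1 - w`, so the error is quadratic and `∑ r k ^ 2 <
∞` suffices for locally uniform convergence. -/
lemma norm_genusOneFactor_sub_one_le {r : ℝ} {z : ℂ} (h1 : ‖(r : ℂ) * z‖ ≤ 1) :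
    ‖genusOneFactor r z - 1‖ ≤ 3 * ‖(r : ℂ) * z‖ ^ 2 := by
  set w := (r : ℂ) * z with hw
  have e : genusOneFactor r z - 1 =
      (Complex.exp w - 1 - w) - w * (Complex.exp w - 1) := by
    rw [genusOneFactor, ← hw]; ring
  rw [e]
  calc _ ≤ ‖Complex.exp w - 1 - w‖ + ‖w‖ * ‖Complex.exp w - 1‖ := by
        rw [← norm_mul]; exact norm_sub_le _ _
    _ ≤ ‖w‖ ^ 2 + ‖w‖ * (2 * ‖w‖) := by
        gcongr
        · exact Complex.norm_exp_sub_one_sub_id_le h1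
        · exact Complex.norm_exp_sub_one_le h1
    _ = _ := by ring

lemma differentiable_genusOneFactor (r : ℝ) : Differentiable ℂ (genusOneFactor r) := by
  unfold genusOneFactor; fun_prop

lemma eventually_norm_genusOneFactor_sub_one_le {r : ℕ → ℝ} (hr : Summable fun k => r k ^ 2)
    (R : ℝ) : ∀ᶠ n in atTop, ∀ z ∈ Metric.ball (0 : ℂ) R,
      ‖genusOneFactor (r n) z - 1‖ ≤ 3 * R ^ 2 * r n ^ 2 := by
  have h0 : Tendsto (fun n => r n ^ 2 * R ^ 2) atTop (𝓝 0) := by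
    simpa using hr.tendsto_atTop_zero.mul_const (R ^ 2)
  filter_upwards [h0.eventually (gt_mem_nhds one_pos)] with n hn z hz
  rw [mem_ball_zero_iff] at hz
  have hle : ‖(r n : ℂ) * z‖ ^ 2 ≤ r n ^ 2 * R ^ 2 := by
    rw [norm_mul, mul_pow, Complex.norm_real, Real.norm_eq_abs, sq_abs]
    gcongr
  have := norm_genusOneFactor_sub_one_le (r := r n) (z := z)
    (by nlinarith [norm_nonneg ((r n : ℂ) * z)])
  linarith

section Product

variable {r : ℕ → ℝ} {P : ℂ → ℂ}

lemma differentiable_of_hasProd_genusOneFactor (hr : Summable fun k => r k ^ 2)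
    (hP : ∀ z, HasProd (fun k => genusOneFactor (r k) z) (P z)) : Differentiable ℂ P := by
  intro z₀
  set R := ‖z₀‖ + 1
  have hl := Summable.hasProdLocallyUniformlyOn_nat_one_add
    (f := fun n z => genusOneFactor (r n) z - 1) (Metric.isOpen_ball (x := (0 : ℂ)) (ε := R))
    (hr.mul_left (3 * R ^ 2)) (eventually_norm_genusOneFactor_sub_one_le hr R)
    (fun n => ((differentiable_genusOneFactor (r n)).sub_const 1).continuous.continuousOn)
  simp only [add_sub_cancel] at hl
  have hd := TendstoLocallyUniformlyOn.differentiableOn hl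
    (Eventually.of_forall fun s => by
      have : Differentiable ℂ fun z => ∏ i ∈ s, genusOneFactor (r i) z :=
        Differentiable.fun_finsetProd fun i _ => differentiable_genusOneFactor (r i)
      exact this.differentiableOn) Metric.isOpen_ball
  have e : (fun z => ∏' i, genusOneFactor (r i) z) = P := funext fun z => (hP z).tprod_eq
  rw [e] at hd
  exact hd.differentiableAt (Metric.isOpen_ball.mem_nhds (by simp [R]))

/-- A convergent canonical product vanishes only at zeros of its factors. -/
lemma exists_mul_eq_one_of_hasProd_eq_zero (hr : Summable fun k => r k ^ 2)
    (hP : ∀ z, HasProd (fun k => genusOneFactor (r k) z) (P z)) {z : ℂ} (hz : P z = 0) :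
    ∃ k, (r k : ℂ) * z = 1 := by
  by_contra! hne
  refine tprod_one_add_ne_zero_of_summable (f := fun k => genusOneFactor (r k) z - 1)
    (fun k => ?_) ?_ ?_
  · rw [add_sub_cancel]
    exact mul_ne_zero (sub_ne_zero.2 (hne k).symm) (Complex.exp_ne_zero _)
  · refine (Summable.of_norm_bounded_eventually_nat (hr.mul_left (3 * (‖z‖ + 1) ^ 2)) ?_)
    filter_upwards [eventually_norm_genusOneFactor_sub_one_le hr (‖z‖ + 1)] with n hn
    rw [norm_norm]
    exact hn z (by simp)
  · simp only [add_sub_cancel]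
    rw [(hP z).tprod_eq, hz]

lemma norm_genusOneFactor_sq (r σ u : ℝ) :
    ‖genusOneFactor r (σ + Complex.I * u)‖ ^ 2 =
      ((1 - r * σ) ^ 2 + (r * u) ^ 2) * Real.exp (r * σ) ^ 2 := by
  rw [genusOneFactor, norm_mul, mul_pow, Complex.norm_exp, Complex.sq_norm, Complex.normSq_apply]
  simp; ring

/-- Because `r` is real, moving vertically only adds an imaginary part to `1 - r σ` and leaves the
modulus of the exponential unchanged. -/
lemma norm_genusOneFactor_ofReal_le (r σ u : ℝ) :
    ‖genusOneFactor r σ‖ ≤ ‖genusOneFactor r (σ + Complex.I * u)‖ := by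
  refine le_of_sq_le_sq ?_ (norm_nonneg _)
  have := norm_genusOneFactor_sq r σ 0
  simp only [Complex.ofReal_zero, mul_zero, add_zero] at this
  rw [this, norm_genusOneFactor_sq]
  refine mul_le_mul_of_nonneg_right ?_ (by positivity)
  nlinarith [sq_nonneg (r * u)]

/-- A factor vanishing at `τ` or `-τ` grows linearly in `u`, quantitatively because `|1 - r σ| ≤ 2`;
this is the source of the `4`. The square root is chosen so that two such factors together gain `1 +
u ^ 2 / (4 * τ ^ 2)`. -/
lemma sqrt_mul_norm_genusOneFactor_ofReal_le {r τ σ : ℝ} (u : ℝ) (hτ : 0 < τ)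
    (hr : r ^ 2 * τ ^ 2 = 1) (hσ : |σ| < τ) :
    √(1 + u ^ 2 / (4 * τ ^ 2)) * ‖genusOneFactor r σ‖ ≤
      ‖genusOneFactor r (σ + Complex.I * u)‖ := by
  refine le_of_sq_le_sq ?_ (norm_nonneg _)
  have := norm_genusOneFactor_sq r σ 0
  simp only [Complex.ofReal_zero, mul_zero, add_zero] at this
  rw [mul_pow, Real.sq_sqrt (by positivity), this, norm_genusOneFactor_sq, ← mul_assoc]
  gcongr
  have h1 : u ^ 2 / (4 * τ ^ 2) = r ^ 2 * u ^ 2 / 4 := by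
    rw [div_eq_div_iff (by positivity) (by norm_num)]
    linear_combination (-4 * u ^ 2) * hr
  have h2 : (r * σ) ^ 2 ≤ 1 := by
    have : σ ^ 2 ≤ τ ^ 2 := sq_le_sq' (by linarith [(abs_lt.1 hσ).1]) (abs_lt.1 hσ).2.le
    rw [mul_pow, ← hr]; gcongr
  have h3 : (1 - r * σ) ^ 2 ≤ 4 := by nlinarith [sq_nonneg (1 + r * σ)]
  rw [h1]
  nlinarith [mul_nonneg (sq_nonneg (r * u)) (sub_nonneg.2 h3)]

/-- The factors `i` and `j` supply the growth and the others do not decrease. The bound is stated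
for partial products because these also need a dominating function independent of `n`. -/
lemma prod_norm_genusOneFactor_ge {i j : ℕ} {τ σ : ℝ} (u : ℝ) (hτ : 0 < τ)
    (hi : r i ^ 2 * τ ^ 2 = 1) (hj : r j ^ 2 * τ ^ 2 = 1) (hij : i ≠ j) (hσ : |σ| < τ)
    {n : ℕ} (hin : i < n) (hjn : j < n) :
    (1 + u ^ 2 / (4 * τ ^ 2)) * ∏ k ∈ Finset.range n, ‖genusOneFactor (r k) σ‖ ≤
      ∏ k ∈ Finset.range n, ‖genusOneFactor (r k) (σ + Complex.I * u)‖ := by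
  set ρ := √(1 + u ^ 2 / (4 * τ ^ 2)) with hρ
  have hρ2 : ρ * ρ = 1 + u ^ 2 / (4 * τ ^ 2) := Real.mul_self_sqrt (by positivity)
  calc _ = ∏ k ∈ Finset.range n, ((if k = i then ρ else 1) * (if k = j then ρ else 1)) *
        ‖genusOneFactor (r k) σ‖ := by
        rw [Finset.prod_mul_distrib, Finset.prod_mul_distrib, Finset.prod_ite_eq',
          Finset.prod_ite_eq', if_pos (Finset.mem_range.2 hin), if_pos (Finset.mem_range.2 hjn),
          hρ2]
    _ ≤ _ := by
        refine Finset.prod_le_prod (fun k _ => by positivity) fun k _ => ?_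
        by_cases h1 : k = i
        · have h2 : k ≠ j := h1 ▸ hij
          rw [if_pos h1, if_neg h2, h1, mul_one]
          exact sqrt_mul_norm_genusOneFactor_ofReal_le u hτ hi hσ
        · by_cases h2 : k = j
          · rw [if_neg h1, if_pos h2, h2, one_mul]
            exact sqrt_mul_norm_genusOneFactor_ofReal_le u hτ hj hσ
          · rw [if_neg h1, if_neg h2, one_mul, one_mul]
            exact norm_genusOneFactor_ofReal_le _ _ _

lemma norm_canonicalProduct_ge (hP : ∀ z, HasProd (fun k => genusOneFactor (r k) z) (P z))
    {i j : ℕ} {τ σ : ℝ} (u : ℝ) (hτ : 0 < τ)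
    (hi : r i ^ 2 * τ ^ 2 = 1) (hj : r j ^ 2 * τ ^ 2 = 1) (hij : i ≠ j) (hσ : |σ| < τ) :
    (1 + u ^ 2 / (4 * τ ^ 2)) * ‖P σ‖ ≤ ‖P (σ + Complex.I * u)‖ := by
  have h1 := ((hP σ).tendsto_prod_nat.norm).const_mul (1 + u ^ 2 / (4 * τ ^ 2))
  have h2 := (hP (σ + Complex.I * u)).tendsto_prod_nat.norm
  simp only [norm_prod] at h1 h2
  refine le_of_tendsto_of_tendsto h1 h2 ?_
  filter_upwards [eventually_gt_atTop i, eventually_gt_atTop j] with n hin hjn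
  exact prod_norm_genusOneFactor_ge u hτ hi hj hij hσ hin hjn

lemma canonicalProduct_zero (hP : ∀ z, HasProd (fun k => genusOneFactor (r k) z) (P z)) :
    P 0 = 1 := by
  have h1 := hP 0
  simp only [genusOneFactor, mul_zero, sub_zero, Complex.exp_zero, mul_one] at h1
  exact h1.unique hasProd_one

lemma canonicalProduct_conj (hP : ∀ z, HasProd (fun k => genusOneFactor (r k) z) (P z)) (x : ℝ) :
    (starRingEnd ℂ) (P x) = P x := by
  have h1 := (hP x).map (starRingEnd ℂ) Complex.continuous_conj
  refine h1.unique ?_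
  convert! hP x using 2 with k
  simp [genusOneFactor, ← Complex.exp_conj]

end Product

/-! ### The quotient `E = F / z²` and its reciprocal. -/

/-- What is left of an even function of the Laguerre-Polya class with a double zero at `0` and
the smallest positive zero `τ`, after division by `z²`. -/
structure EvenQuotient (E : ℂ → ℂ) (τ : ℝ) where
  (C γ b : ℝ)
  r : ℕ → ℝ
  P : ℂ → ℂ
  (i j : ℕ)
  C_pos : 0 < C
  γ_nonneg : 0 ≤ γ
  τ_pos : 0 < τ
  summable : Summable fun k => r k ^ 2
  hasProd : ∀ z, HasProd (fun k => genusOneFactor (r k) z) (P z)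
  eq : ∀ z, E z = C * Complex.exp (-(γ : ℂ) * z ^ 2 + (b : ℂ) * z) * P z
  even : ∀ z, E (-z) = E z
  ne_zero : ∀ x : ℝ, |x| < τ → E x ≠ 0
  r_i : r i ^ 2 * τ ^ 2 = 1
  r_j : r j ^ 2 * τ ^ 2 = 1
  i_ne_j : i ≠ j

lemma exists_evenQuotient {F : ℂ → ℂ} {τ : ℝ} (hLP : LaguerrePolya F)
    (heven : ∀ z : ℂ, F (-z) = F z) (hzero : analyticOrderAt F 0 = 2)
    (hτ : 0 < τ) (hFτ : F (τ : ℂ) = 0)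
    (hpos : ∀ x : ℝ, 0 < x → x < τ → 0 < F (x : ℂ)) :
    ∃ E : ℂ → ℂ, (∀ z, F z = z ^ 2 * E z) ∧ Nonempty (EvenQuotient E τ) := by
  obtain ⟨C, γ, b, κ, r, P, hγ, hr, hP, hF⟩ := hLP
  have hP' : ∀ z, HasProd (fun k => genusOneFactor (r k) z) (P z) := hP
  have hPd := differentiable_of_hasProd_genusOneFactor hr hP'
  set E : ℂ → ℂ := fun z => C * Complex.exp (-(γ : ℂ) * z ^ 2 + (b : ℂ) * z) * P z with hE
  have hEd : Differentiable ℂ E := by fun_prop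
  have hE0 : E 0 = C := by simp [hE, canonicalProduct_zero hP']
  have hFE : F = fun z => z ^ κ * E z := by ext z; rw [hF]; simp only [hE]; ring
  have hC : C ≠ 0 := by
    rintro rfl
    have := (hpos (τ / 2) (by linarith) (by linarith)).ne'
    rw [hF] at this; simp at this
  have hκ : κ = 2 := by
    have h1 : analyticOrderAt F 0 = κ := by
      have hFa : AnalyticAt ℂ F 0 := by
        rw [hFE]; exact (by fun_prop : Differentiable ℂ fun z => z ^ κ * E z).analyticAt 0
      rw [hFa.analyticOrderAt_eq_natCast]
      refine ⟨E, hEd.analyticAt 0, by rw [hE0]; exact_mod_cast hC, ?_⟩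
      exact Eventually.of_forall fun z => by rw [hFE]; simp
    rw [h1] at hzero
    exact_mod_cast hzero
  subst hκ
  have hFz : ∀ z, F z = z ^ 2 * E z := fun z => congrFun hFE z
  have hEe : ∀ z, E (-z) = E z := by
    intro z
    rcases eq_or_ne z 0 with rfl | hz
    · simp
    · have := heven z
      rw [hFz, hFz, neg_sq] at this
      exact mul_left_cancel₀ (pow_ne_zero 2 hz) this
  have hEpos : ∀ x : ℝ, 0 < x → x < τ → 0 < E x := by
    intro x h0 h1
    have := hpos x h0 h1
    rw [hFz] at this
    exact pos_of_mul_pos_right this (by exact_mod_cast (sq_nonneg x))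
  -- `C = E 0` is a limit of positive values from the right, hence nonnegative, and it is not zero.
  have hCpos : 0 < C := by
    refine lt_of_le_of_ne ?_ hC.symm
    have ht : Tendsto (fun x : ℝ => (E x).re) (𝓝[>] 0) (𝓝 C) := by
      have h1 : ContinuousAt (fun x : ℝ => (E x).re) 0 :=
        (Complex.continuous_re.comp
          (hEd.continuous.comp Complex.continuous_ofReal)).continuousAt
      have h2 := h1.tendsto.mono_left (nhdsWithin_le_nhds (s := Ioi (0 : ℝ)))
      simpa [hE0] using h2
    refine ge_of_tendsto ht ?_
    filter_upwards [Ioo_mem_nhdsGT hτ] with x hx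
    exact (Complex.le_def.1 (hEpos x hx.1 hx.2).le).1
  have hPz : ∀ z : ℂ, z ≠ 0 → F z = 0 → P z = 0 := by
    intro z hz h0
    rw [hFz, mul_eq_zero] at h0
    have := h0.resolve_left (pow_ne_zero 2 hz)
    simp only [hE, mul_eq_zero] at this
    rcases this with (h | h) | h
    · exact absurd h (by exact_mod_cast hC)
    · exact absurd h (Complex.exp_ne_zero _)
    · exact h
  have hτ0 : (τ : ℂ) ≠ 0 := by exact_mod_cast hτ.ne'
  -- By evenness both `τ` and `-τ` are zeros; they come from different factors since `r i` and `r j`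
  -- have opposite signs.
  obtain ⟨i, hi⟩ := exists_mul_eq_one_of_hasProd_eq_zero hr hP' (hPz τ hτ0 hFτ)
  obtain ⟨j, hj⟩ := exists_mul_eq_one_of_hasProd_eq_zero hr hP'
    (hPz (-τ) (neg_ne_zero.2 hτ0) (by rw [heven, hFτ]))
  have hi' : r i * τ = 1 := by exact_mod_cast hi
  have hj' : r j * -τ = 1 := by exact_mod_cast hj
  refine ⟨E, hFz, ⟨⟨C, γ, b, r, P, i, j, hCpos, hγ, hτ, hr, hP', fun z => rfl, hEe, ?_, ?_, ?_, ?_⟩⟩⟩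
  · intro x hx
    rcases lt_trichotomy x 0 with h | h | h
    · have := (hEpos (-x) (by linarith) (by rwa [abs_of_neg h] at hx)).ne'
      rwa [Complex.ofReal_neg, hEe] at this
    · rw [h, Complex.ofReal_zero, hE0]; exact_mod_cast hC
    · exact (hEpos x h (by rwa [abs_of_pos h] at hx)).ne'
  · rw [← mul_pow, hi', one_pow]
  · rw [← mul_pow, ← neg_sq, ← mul_neg, hj', one_pow]
  · rintro rfl
    linarith

namespace EvenQuotient

variable {E : ℂ → ℂ} {τ : ℝ}

lemma differentiable (D : EvenQuotient E τ) : Differentiable ℂ E := by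
  have := differentiable_of_hasProd_genusOneFactor D.summable D.hasProd
  rw [funext D.eq]
  fun_prop

/-- Both parts of `E` grow away from the real axis: `Re (-γ (σ + iu)²) = -γ σ² + γ u²` with `γ ≥ 0`,
and the product gains a quadratic factor. In particular a zero in the strip would force one on the
real interval `(-τ, τ)`. -/
lemma norm_ge (D : EvenQuotient E τ) {σ : ℝ} (hσ : |σ| < τ) (u : ℝ) :
    (1 + u ^ 2 / (4 * τ ^ 2)) * ‖E σ‖ ≤ ‖E (σ + Complex.I * u)‖ := by
  have hP := norm_canonicalProduct_ge D.hasProd u D.τ_pos D.r_i D.r_j D.i_ne_j hσ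
  have hC : ‖(D.C : ℂ)‖ = D.C := by simp [abs_of_pos D.C_pos]
  rw [D.eq, D.eq, norm_mul, norm_mul, norm_mul, norm_mul, Complex.norm_exp, Complex.norm_exp, hC,
    mul_left_comm]
  refine mul_le_mul (mul_le_mul_of_nonneg_left (Real.exp_le_exp.2 ?_) D.C_pos.le) hP
    (by positivity) (mul_nonneg D.C_pos.le (Real.exp_nonneg _))
  have : (-(D.γ : ℂ) * (σ + Complex.I * u) ^ 2 + D.b * (σ + Complex.I * u)).re =
      (-(D.γ : ℂ) * (σ : ℂ) ^ 2 + D.b * (σ : ℂ)).re + D.γ * u ^ 2 := by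
    simp [pow_two]; ring
  rw [this]
  nlinarith [mul_nonneg D.γ_nonneg (sq_nonneg u)]

lemma ne_zero_of_abs_re_lt (D : EvenQuotient E τ) {z : ℂ} (hz : |z.re| < τ) : E z ≠ 0 := by
  have h1 := D.norm_ge hz z.im
  rw [mul_comm Complex.I, Complex.re_add_im] at h1
  have h2 : 0 < ‖E z.re‖ := norm_pos_iff.2 (D.ne_zero _ hz)
  exact norm_pos_iff.1 (lt_of_lt_of_le (by positivity) h1)

lemma inv_one_add_sq_div_le {τ : ℝ} (hτ : 0 < τ) (u : ℝ) :
    (1 + u ^ 2 / (4 * τ ^ 2))⁻¹ ≤ (1 + 4 * τ ^ 2) * (1 + u ^ 2)⁻¹ := by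
  rw [← div_eq_mul_inv, inv_le_comm₀ (by positivity) (by positivity), inv_div,
    div_le_iff₀ (by positivity)]
  have : u ^ 2 / (4 * τ ^ 2) * (4 * τ ^ 2) = u ^ 2 := by field_simp
  nlinarith [this, (by positivity : 0 ≤ u ^ 2 / (4 * τ ^ 2)), sq_nonneg τ]

/-- The reciprocal decays quadratically on the zero-free strip. -/
lemma stripDecay_inv (D : EvenQuotient E τ) : StripDecay (fun s => (E s)⁻¹) (-τ) τ where
  diff := fun z hz => (D.differentiable z).differentiableWithinAt.inv
    (D.ne_zero_of_abs_re_lt (abs_lt.2 hz))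
  decay c₁ c₂ h1 h12 h2 := by
    have hτ := D.τ_pos
    have hcont : ContinuousOn (fun σ : ℝ => ‖E σ‖⁻¹) (Icc c₁ c₂) := by
      refine ContinuousOn.inv₀ ?_ fun σ hσ => ?_
      · exact (D.differentiable.continuous.comp Complex.continuous_ofReal).norm.continuousOn
      · exact norm_ne_zero_iff.2 (D.ne_zero σ (abs_lt.2 ⟨h1.trans_le hσ.1, hσ.2.trans_lt h2⟩))
    obtain ⟨M, hM⟩ := isCompact_Icc.exists_bound_of_continuousOn hcont
    refine ⟨M * (1 + 4 * τ ^ 2), fun σ hσ u => ?_⟩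
    have hσ' : |σ| < τ := abs_lt.2 ⟨h1.trans_le hσ.1, hσ.2.trans_lt h2⟩
    have hM' := (le_abs_self _).trans (hM σ hσ)
    have h3 : 0 < ‖E σ‖ := norm_pos_iff.2 (D.ne_zero σ hσ')
    have hM0 : 0 ≤ M := (by positivity : 0 ≤ ‖E σ‖⁻¹).trans hM'
    rw [norm_inv]
    calc ‖E (σ + Complex.I * u)‖⁻¹ ≤ ((1 + u ^ 2 / (4 * τ ^ 2)) * ‖E σ‖)⁻¹ := by
          gcongr; exact D.norm_ge hσ' u
      _ = ‖E σ‖⁻¹ * (1 + u ^ 2 / (4 * τ ^ 2))⁻¹ := by rw [mul_inv, mul_comm]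
      _ ≤ M * ((1 + 4 * τ ^ 2) * (1 + u ^ 2)⁻¹) :=
          mul_le_mul hM' (inv_one_add_sq_div_le hτ u) (by positivity) hM0
      _ = _ := by ring

lemma conj_eq (D : EvenQuotient E τ) (x : ℝ) : (starRingEnd ℂ) (E x) = E x := by
  rw [D.eq, map_mul, map_mul, canonicalProduct_conj D.hasProd, ← Complex.exp_conj]
  simp

lemma ofReal_re (D : EvenQuotient E τ) (x : ℝ) : ((E x).re : ℂ) = E x :=
  Complex.conj_eq_iff_re.1 (D.conj_eq x)

end EvenQuotient

/-! ### Nonnegativity of the inverse transform of `1 / E`. -/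

/-- Functions on the imaginary axis with nonnegative inverse transform. -/
structure NonnegTransform (ψ : ℂ → ℂ) : Prop where
  integrable : Integrable fun u : ℝ => ψ (((0 : ℝ) : ℂ) + Complex.I * u)
  nonneg : ∀ t, 0 ≤ lineInv ψ 0 t

lemma nonnegTransform_gaussian {γ : ℝ} (hγ : 0 < γ) (b : ℝ) :
    NonnegTransform fun s => Complex.exp ((γ : ℂ) * s ^ 2 - (b : ℂ) * s) where
  integrable := by
    have := integrable_cexp_quadratic (b := (γ : ℂ)) (by simpa using hγ)
      (-(b * Complex.I)) 0
    refine this.congr (ae_of_all _ fun u => ?_)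
    simp only
    congr 1
    rw [Complex.ofReal_zero, zero_add, mul_pow, Complex.I_sq]; ring
  nonneg t := by
    have e : ∀ u : ℝ, Complex.exp ((((0 : ℝ) : ℂ) + Complex.I * (u : ℂ)) * (t : ℂ)) *
        Complex.exp ((γ : ℂ) * (((0 : ℝ) : ℂ) + Complex.I * (u : ℂ)) ^ 2 -
          (b : ℂ) * (((0 : ℝ) : ℂ) + Complex.I * (u : ℂ))) =
        Complex.exp (Complex.I * ((t - b : ℝ) : ℂ) * u) *
          Complex.exp (-(γ : ℂ) * (u : ℂ) ^ 2) := by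
      intro u
      rw [← Complex.exp_add, ← Complex.exp_add, Complex.ofReal_zero, zero_add, mul_pow,
        Complex.I_sq]
      congr 1; push_cast; ring
    rw [lineInv]
    simp only [e]
    rw [fourierIntegral_gaussian (by simpa using hγ)]
    have h1 : ((Real.pi : ℂ) / γ) ^ (1 / 2 : ℂ) = (((Real.pi / γ) ^ (1 / 2 : ℝ) : ℝ) : ℂ) := by
      rw [Complex.ofReal_cpow (by positivity)]; push_cast; rfl
    have h2 : Complex.exp (-((t - b : ℝ) : ℂ) ^ 2 / (4 * γ)) =
        ((Real.exp (-(t - b) ^ 2 / (4 * γ)) : ℝ) : ℂ) := by push_cast; rfl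
    have h3 : 1 / (2 * (Real.pi : ℂ)) = ((1 / (2 * Real.pi) : ℝ) : ℂ) := by push_cast; rfl
    rw [h1, h2, h3, ← Complex.ofReal_mul, ← Complex.ofReal_mul]
    exact Complex.zero_le_real.2 (by positivity)

lemma one_le_norm_genusOneFactor (r u : ℝ) :
    1 ≤ ‖genusOneFactor r (((0 : ℝ) : ℂ) + Complex.I * u)‖ := by
  have := norm_genusOneFactor_ofReal_le r 0 u
  simpa [genusOneFactor] using this

/-- For `Re s = 0`, `1 / ((1 - r s) e^{rs}) = ∫_0^∞ e^{-v} e^{-s r (1 - v)} dv`. Multiplying by the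
reciprocal factor therefore averages translates of the inverse transform with positive weights. -/
lemma NonnegTransform.mul_inv_genusOneFactor {ψ : ℂ → ℂ} (hψ : NonnegTransform ψ) (r : ℝ) :
    NonnegTransform fun s => ψ s * (genusOneFactor r s)⁻¹ where
  integrable := by
    refine hψ.integrable.mul_bdd (c := 1) ?_ (ae_of_all _ fun u => ?_)
    · have h : Continuous fun u : ℝ => genusOneFactor r (((0 : ℝ) : ℂ) + Complex.I * u) :=
        (differentiable_genusOneFactor r).continuous.comp (by fun_prop)
      exact h.measurable.inv.aestronglyMeasurable
    · rw [norm_inv]; exact inv_le_one_of_one_le₀ (one_le_norm_genusOneFactor r u)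
  nonneg t := by
    have hre : ∀ u : ℝ, (-1 + (r : ℂ) * (Complex.I * u)).re < 0 := fun u => by simp
    have hexp : ∀ u v : ℝ, Complex.exp (-(v : ℂ)) *
        Complex.exp (-(((0 : ℝ) : ℂ) + Complex.I * u) * ((r * (1 - v) : ℝ) : ℂ)) =
        Complex.exp (-(r * (Complex.I * u))) *
          Complex.exp ((-1 + (r : ℂ) * (Complex.I * u)) * v) := by
      intro u v
      rw [← Complex.exp_add, ← Complex.exp_add]
      congr 1; push_cast; ring
    have key := integral_mul_lineInv_sub (χ := fun s => ψ s * (genusOneFactor r s)⁻¹)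
      hψ.integrable (μ := volume.restrict (Ioi (0 : ℝ))) (κ := fun v => Complex.exp (-(v : ℂ)))
      (y := fun v => r * (1 - v)) (by fun_prop) ?_ ?_ t
    · rw [← key]
      refine integral_nonneg fun v => ?_
      have : Complex.exp (-(v : ℂ)) = ((Real.exp (-v) : ℝ) : ℂ) := by push_cast; rfl
      simp only [this]
      exact mul_nonneg (Complex.zero_le_real.2 (Real.exp_nonneg _)) (hψ.nonneg _)
    · have := integrableOn_exp_mul_complex_Ioi (hre 0) 0
      refine this.congr (ae_of_all _ fun v => ?_)
      simp
    · intro u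
      simp only [hexp]
      rw [integral_const_mul, integral_exp_mul_complex_Ioi (hre u)]
      congr 1
      simp only [genusOneFactor, Complex.ofReal_zero, zero_add, mul_inv, ← Complex.exp_neg,
        mul_zero, Complex.exp_zero]
      rw [mul_comm]
      congr 1
      rw [neg_div, ← one_div, ← div_neg]; congr 1; ring

lemma nonnegTransform_partialProduct {γ : ℝ} (hγ : 0 < γ) (b : ℝ) (r : ℕ → ℝ) (n : ℕ) :
    NonnegTransform fun s => Complex.exp ((γ : ℂ) * s ^ 2 - (b : ℂ) * s) *
      (∏ k ∈ Finset.range n, genusOneFactor (r k) s)⁻¹ := by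
  induction n with
  | zero => simpa using nonnegTransform_gaussian hγ b
  | succ n ih =>
    have := ih.mul_inv_genusOneFactor (r n)
    simpa only [Finset.prod_range_succ, mul_inv, mul_assoc] using this

namespace EvenQuotient

variable {E : ℂ → ℂ} {τ : ℝ}

lemma zero_mem (D : EvenQuotient E τ) : (0 : ℝ) ∈ Ioo (-τ) τ := ⟨by linarith [D.τ_pos], D.τ_pos⟩

/-- The reciprocal of a Laguerre-Polya function is the transform of a nonnegative function. -/
lemma lineInv_inv_nonneg (D : EvenQuotient E τ) (t : ℝ) : 0 ≤ lineInv (fun s => (E s)⁻¹) 0 t := by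
  have hτ := D.τ_pos
  -- The vanishing extra `ε n` keeps the Gaussian nondegenerate when `γ = 0`, so that every
  -- approximant is integrable.
  set ε : ℕ → ℝ := fun n => 1 / ((n : ℝ) + 1) with hε
  have hεpos : ∀ n, 0 < ε n := fun n => by positivity
  set ψ : ℕ → ℂ → ℂ := fun n s =>
    Complex.exp (((D.γ + ε n : ℝ) : ℂ) * s ^ 2 - (D.b : ℂ) * s) *
      (∏ k ∈ Finset.range n, genusOneFactor (D.r k) s)⁻¹ with hψdef
  have hψ : ∀ n, NonnegTransform (ψ n) := fun n =>
    nonnegTransform_partialProduct (add_pos_of_nonneg_of_pos D.γ_nonneg (hεpos n)) D.b D.r n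
  have hPne : ∀ u : ℝ, D.P (((0 : ℝ) : ℂ) + Complex.I * u) ≠ 0 := fun u h => by
    have := D.ne_zero_of_abs_re_lt (z := ((0 : ℝ) : ℂ) + Complex.I * u) (by simpa using hτ)
    rw [D.eq, h, mul_zero] at this
    exact this rfl
  have hlim : ∀ u : ℝ, Tendsto (fun n => ψ n (((0 : ℝ) : ℂ) + Complex.I * u)) atTop
      (𝓝 (D.C * (E (((0 : ℝ) : ℂ) + Complex.I * u))⁻¹)) := by
    intro u
    set s := ((0 : ℝ) : ℂ) + Complex.I * u
    have h1 : Tendsto (fun n => Complex.exp (((D.γ + ε n : ℝ) : ℂ) * s ^ 2 - (D.b : ℂ) * s)) atTop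
        (𝓝 (Complex.exp (((D.γ + 0 : ℝ) : ℂ) * s ^ 2 - (D.b : ℂ) * s))) := by
      have h2 : Tendsto (fun n => ((D.γ + ε n : ℝ) : ℂ)) atTop (𝓝 ((D.γ + 0 : ℝ) : ℂ)) :=
        (Complex.continuous_ofReal.tendsto _).comp
          (tendsto_one_div_add_atTop_nhds_zero_nat.const_add D.γ)
      exact ((h2.mul_const _).sub_const _).cexp
    have h3 := h1.mul ((D.hasProd s).tendsto_prod_nat.inv₀ (hPne u))
    convert! h3 using 2
    have hC : (D.C : ℂ) ≠ 0 := by exact_mod_cast D.C_pos.ne'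
    rw [D.eq, mul_inv, mul_inv, ← mul_assoc, ← mul_assoc, mul_inv_cancel₀ hC, one_mul,
      ← Complex.exp_neg, add_zero]
    congr 2; ring
  -- Once the partial product contains both factors with zeros `±τ`, the decay is quadratic
  -- uniformly in `n`.
  have hle : ∀ᶠ n in atTop, ∀ u : ℝ, ‖ψ n (((0 : ℝ) : ℂ) + Complex.I * u)‖ ≤
      (1 + 4 * τ ^ 2) * (1 + u ^ 2)⁻¹ := by
    filter_upwards [eventually_gt_atTop D.i, eventually_gt_atTop D.j] with n hin hjn u
    have h1 := prod_norm_genusOneFactor_ge u hτ D.r_i D.r_j D.i_ne_j (σ := 0) (by simpa) hin hjn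
    refine le_trans ?_ (inv_one_add_sq_div_le hτ u)
    have h2 : ∏ k ∈ Finset.range n, ‖genusOneFactor (D.r k) ((0 : ℝ) : ℂ)‖ = 1 :=
      Finset.prod_eq_one fun k _ => by simp [genusOneFactor]
    rw [h2, mul_one] at h1
    simp only [hψdef]
    rw [norm_mul, norm_inv, norm_prod, Complex.norm_exp]
    have h3 : ((((D.γ + ε n : ℝ) : ℂ)) * (((0 : ℝ) : ℂ) + Complex.I * u) ^ 2 -
        (D.b : ℂ) * (((0 : ℝ) : ℂ) + Complex.I * u)).re = -((D.γ + ε n) * u ^ 2) := by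
      simp [pow_two]
    rw [h3]
    have h4 : Real.exp (-((D.γ + ε n) * u ^ 2)) ≤ 1 := Real.exp_le_one_iff.2 (by
      have := D.γ_nonneg
      have := hεpos n
      simp only [Left.neg_nonpos_iff]
      positivity)
    calc _ ≤ 1 * (1 + u ^ 2 / (4 * τ ^ 2))⁻¹ := by gcongr
      _ = _ := one_mul _
  have hT : Tendsto (fun n => lineInv (ψ n) 0 t) atTop
      (𝓝 (lineInv (fun s => D.C * (E s)⁻¹) 0 t)) := by
    refine Tendsto.const_mul _ ?_
    refine tendsto_integral_filter_of_dominated_convergence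
      (fun u => (1 + 4 * τ ^ 2) * (1 + u ^ 2)⁻¹)
      (Eventually.of_forall fun n => ?_) ?_ (integrable_inv_one_add_sq.const_mul _)
      (ae_of_all _ fun u => (hlim u).const_mul _)
    · exact (Continuous.aestronglyMeasurable (by fun_prop)).mul (hψ n).integrable.1
    · filter_upwards [hle] with n hn
      refine ae_of_all _ fun u => ?_
      rw [norm_mul, norm_exp_line]
      simpa using hn u
  have h0 : 0 ≤ lineInv (fun s => D.C * (E s)⁻¹) 0 t := ge_of_tendsto' hT fun n => (hψ n).nonneg t
  have h1 : lineInv (fun s => D.C * (E s)⁻¹) 0 t = D.C * lineInv (fun s => (E s)⁻¹) 0 t := by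
    simp only [lineInv, mul_left_comm _ (D.C : ℂ), integral_const_mul]
  have hC : (D.C : ℂ) ≠ 0 := by exact_mod_cast D.C_pos.ne'
  have hC' : (0 : ℂ) ≤ ((D.C⁻¹ : ℝ) : ℂ) := Complex.zero_le_real.2 (inv_nonneg.2 D.C_pos.le)
  rw [h1] at h0
  have h2 := mul_nonneg hC' h0
  rwa [Complex.ofReal_inv, inv_mul_cancel_left₀ hC] at h2

lemma lineInv_inv_neg (D : EvenQuotient E τ) (t : ℝ) :
    lineInv (fun s => (E s)⁻¹) 0 (-t) = lineInv (fun s => (E s)⁻¹) 0 t := by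
  simp only [lineInv]
  congr 1
  rw [← integral_neg_eq_self]
  congr 1; ext u
  rw [← D.even]
  congr 2
  · push_cast; ring
  · congr 1; push_cast; ring

end EvenQuotient

/-! ### The elementary exponential-trigonometric inequality. -/

lemma exp_neg_mul_le_one {u : ℝ} (hu : 0 ≤ u) : Real.exp (-u) * (1 + u + u ^ 2 / 2) ≤ 1 := by
  have h := Real.quadratic_le_exp_of_nonneg hu
  calc _ ≤ Real.exp (-u) * Real.exp u := by gcongr
    _ = 1 := by rw [← Real.exp_add]; simp

/-- The product `(1 - u + u²/2)(1 + u + u²/2)` equals `1 + u⁴/4`, which is at least `1`. -/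
lemma exp_neg_le_quadratic {u : ℝ} (hu : 0 ≤ u) : Real.exp (-u) ≤ 1 - u + u ^ 2 / 2 := by
  have h := exp_neg_mul_le_one hu
  by_contra! hc
  nlinarith [mul_lt_mul_of_pos_right hc (by positivity : 0 < 1 + u + u ^ 2 / 2), sq_nonneg (u ^ 2)]

/-- The elementary inequality behind the positivity for positive arguments. -/
lemma one_sub_exp_add_cos_sub_sin_nonneg {y θ : ℝ} (hy : 0 ≤ y) (hθ : 0 ≤ θ) :
    0 ≤ 1 - Real.exp (-(y * θ)) + y ^ 2 * (1 + Real.cos θ) - y * Real.sin θ := by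
  have hu : 0 ≤ y * θ := mul_nonneg hy hθ
  -- The threshold `3/4` is large enough for `1 + u + u²/2 ≥ 2`, giving `e^{-u} ≤ 1/2`; half-angle
  -- formulas then leave `(2 y cos(θ/2) - sin(θ/2))² / 2` plus a nonnegative remainder.
  rcases le_or_gt (3 / 4) (y * θ) with h | h
  · have h1 : Real.exp (-(y * θ)) ≤ 1 / 2 := by
      have h2 := exp_neg_mul_le_one hu
      nlinarith [Real.exp_pos (-(y * θ))]
    have hc : Real.cos θ = 2 * Real.cos (θ / 2) ^ 2 - 1 := by
      rw [← Real.cos_two_mul]; congr 1; ring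
    have hs : Real.sin θ = 2 * Real.sin (θ / 2) * Real.cos (θ / 2) := by
      rw [← Real.sin_two_mul]; congr 1; ring
    rw [hc, hs]
    nlinarith [sq_nonneg (2 * y * Real.cos (θ / 2) - Real.sin (θ / 2)),
      Real.sin_sq_le_one (θ / 2)]
  · have h1 := exp_neg_le_quadratic hu
    -- With `u = yθ < 3/4`, one has `u - u²/2 ≥ (5/8) yθ`, which already exceeds `y` when `θ ≥ 8/5`.
    rcases le_or_gt (8 / 5) θ with h2 | h2
    · have h3 : 0 ≤ y ^ 2 * (1 + Real.cos θ) :=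
        mul_nonneg (sq_nonneg y) (by linarith [Real.neg_one_le_cos θ])
      have h4 : y * Real.sin θ ≤ y := mul_le_of_le_one_right hy (Real.sin_le_one θ)
      nlinarith [mul_nonneg hy (sub_nonneg.2 h2), mul_nonneg hu (sub_nonneg.2 h.le)]
    -- For smaller `θ` the quadratic bounds on `exp` and `cos` reduce the claim to `sin θ ≤ θ + y (2
    -- - θ²)`. The sign of `2 - θ²` decides whether `sin θ ≤ θ` or `sin θ ≤ 1` is the useful bound.
    · have h3 : y ^ 2 * (2 - θ ^ 2 / 2) ≤ y ^ 2 * (1 + Real.cos θ) :=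
        mul_le_mul_of_nonneg_left (by linarith [Real.one_sub_sq_div_two_le_cos (x := θ)])
          (sq_nonneg y)
      rcases le_or_gt (θ ^ 2) 2 with h4 | h4
      · have h5 : y * Real.sin θ ≤ y * θ := mul_le_mul_of_nonneg_left (Real.sin_le hθ) hy
        nlinarith [mul_nonneg (sq_nonneg y) (sub_nonneg.2 h4)]
      · have h5 : y * Real.sin θ ≤ y := mul_le_of_le_one_right hy (Real.sin_le_one θ)
        have h6 : 7 / 5 ≤ θ := by nlinarith
        have h7 : 1 ≤ θ + y * (2 - θ ^ 2) := by nlinarith [mul_nonneg hy (sub_nonneg.2 h6)]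
        nlinarith [mul_le_mul_of_nonneg_left h7 hy]

/-! ### The ramp kernel and its symmetrized inequalities. -/

/-- The inverse Laplace transform of `a / (s² (s² + a²))` on the right half plane. -/
noncomputable def ramp (a v : ℝ) : ℝ := (max v 0 - Real.sin (a * max v 0) / a) / a

section Ramp

variable {a : ℝ}

lemma ramp_of_nonneg (a : ℝ) {v : ℝ} (hv : 0 ≤ v) : ramp a v = (v - Real.sin (a * v) / a) / a := by
  rw [ramp, max_eq_left hv]

lemma ramp_of_nonpos (a : ℝ) {v : ℝ} (hv : v ≤ 0) : ramp a v = 0 := by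
  rw [ramp, max_eq_right hv]; simp

@[fun_prop]
lemma continuous_ramp (a : ℝ) : Continuous (ramp a) := by
  unfold ramp; fun_prop

lemma ramp_nonneg (ha : 0 < a) (v : ℝ) : 0 ≤ ramp a v := by
  have h : 0 ≤ max v 0 := le_max_right _ _
  have h1 := Real.sin_le (mul_nonneg ha.le h)
  have h2 : Real.sin (a * max v 0) / a ≤ max v 0 := by
    rw [div_le_iff₀ ha]; linarith
  exact div_nonneg (by linarith) ha.le

/-- For `v > 0` the slope of `ramp a` is `(1 - cos (a v)) / a`, at most `2 / a`; the bound is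
obtained from the Lipschitz estimate for the sine. -/
lemma ramp_sub_le (ha : 0 < a) {v w : ℝ} (hvw : v ≤ w) :
    ramp a w - ramp a v ≤ 2 / a * (w - v) := by
  have h1 : max v 0 ≤ max w 0 := max_le_max_right 0 hvw
  have h2 : max w 0 - max v 0 ≤ w - v := by
    rcases max_cases v 0 with h | h <;> rcases max_cases w 0 with h' | h' <;> linarith
  have h3 : Real.sin (a * max v 0) - Real.sin (a * max w 0) ≤ a * (max w 0 - max v 0) := by
    have := Real.abs_sin_sub_sin_le (a * max v 0) (a * max w 0)
    rw [abs_sub_comm (a * _), abs_of_nonneg (a := a * max w 0 - a * max v 0)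
      (by nlinarith)] at this
    linarith [le_abs_self (Real.sin (a * max v 0) - Real.sin (a * max w 0))]
  have h4 : ramp a w - ramp a v = ((max w 0 - max v 0) +
      (Real.sin (a * max v 0) - Real.sin (a * max w 0)) / a) / a := by
    rw [ramp, ramp]; ring
  have h5 : (Real.sin (a * max v 0) - Real.sin (a * max w 0)) / a ≤ max w 0 - max v 0 := by
    rw [div_le_iff₀ ha]; linarith
  rw [h4, div_mul_eq_mul_div]
  gcongr
  linarith

lemma ramp_le_exp (ha : 0 < a) {c : ℝ} (hc : 0 < c) (v : ℝ) :
    ramp a v ≤ 2 / (a * c) * Real.exp (c * v) := by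
  rcases le_total v 0 with h | h
  · rw [ramp_of_nonpos a h]; positivity
  · have h1 := ramp_sub_le ha h
    rw [ramp_of_nonpos a le_rfl, sub_zero, sub_zero] at h1
    refine h1.trans ?_
    have h2 := Real.add_one_le_exp (c * v)
    calc 2 / a * v = 2 / (a * c) * (c * v) := by field_simp
      _ ≤ _ := by gcongr; linarith

lemma integrableOn_ramp_mul_exp (ha : 0 < a) {x : ℝ} (hx : 0 < x) (p : ℝ) :
    IntegrableOn (fun v => ramp a v * Real.exp (-(x * v))) (Ioi p) := by
  refine Integrable.mono' ((integrableOn_exp_mul_Ioi (a := -(x / 2)) (by linarith) p).const_mul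
    (2 / (a * (x / 2)))) (by fun_prop) (ae_of_all _ fun v => ?_)
  rw [Real.norm_of_nonneg (mul_nonneg (ramp_nonneg ha v) (Real.exp_nonneg _))]
  calc _ ≤ 2 / (a * (x / 2)) * Real.exp (x / 2 * v) * Real.exp (-(x * v)) := by
        gcongr; exact ramp_le_exp ha (by linarith) v
    _ = _ := by rw [mul_assoc, ← Real.exp_add]; congr 2; ring

lemma integral_Ioi_ramp_mul_exp (ha : 0 < a) {x p : ℝ} (hx : 0 < x) (hp : 0 ≤ p) :
    ∫ v in Ioi p, ramp a v * Real.exp (-(x * v)) =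
      Real.exp (-(x * p)) * ((p / x + 1 / x ^ 2) / a -
        (x * Real.sin (a * p) + a * Real.cos (a * p)) / (a ^ 2 * (x ^ 2 + a ^ 2))) := by
  -- An explicit primitive of the integrand that vanishes at infinity.
  set G : ℝ → ℝ := fun v => -(Real.exp (-(x * v)) * ((v / x + 1 / x ^ 2) / a -
    (x * Real.sin (a * v) + a * Real.cos (a * v)) / (a ^ 2 * (x ^ 2 + a ^ 2)))) with hG
  have hx2 : x ^ 2 + a ^ 2 ≠ 0 := by positivity
  have hderiv : ∀ v ∈ Ici p, HasDerivAt G (ramp a v * Real.exp (-(x * v))) v := by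
    intro v hv
    have hl : ∀ b : ℝ, HasDerivAt (fun v : ℝ => b * v) b v := fun b => by
      simpa using (hasDerivAt_id v).const_mul b
    have he : HasDerivAt (fun v => Real.exp (-(x * v))) (Real.exp (-(x * v)) * -x) v :=
      (hl x).neg.exp
    have hs : HasDerivAt (fun v => Real.sin (a * v)) (Real.cos (a * v) * a) v := (hl a).sin
    have hc : HasDerivAt (fun v => Real.cos (a * v)) (-Real.sin (a * v) * a) v := (hl a).cos
    have := (he.mul (((((hasDerivAt_id v).div_const x).add_const (1 / x ^ 2)).div_const a).sub
      (((hs.const_mul x).add (hc.const_mul a)).div_const (a ^ 2 * (x ^ 2 + a ^ 2))))).neg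
    refine this.congr_deriv ?_
    rw [ramp_of_nonneg a (hp.trans hv)]
    simp only [id, Pi.add_apply, Pi.sub_apply]
    field_simp
    ring
  have hexp : Tendsto (fun v => Real.exp (-(x * v))) atTop (𝓝 0) :=
    Real.tendsto_exp_neg_atTop_nhds_zero.comp (tendsto_id.const_mul_atTop hx)
  have hvexp : Tendsto (fun v => v * Real.exp (-(x * v))) atTop (𝓝 0) := by
    simpa using tendsto_rpow_mul_exp_neg_mul_atTop_nhds_zero 1 x hx
  have hosc : Tendsto (fun v => (x * Real.sin (a * v) + a * Real.cos (a * v)) *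
      Real.exp (-(x * v))) atTop (𝓝 0) := by
    refine squeeze_zero_norm (fun v => ?_) (by simpa using hexp.const_mul (x + a))
    rw [norm_mul, Real.norm_of_nonneg (Real.exp_nonneg _)]
    gcongr
    rw [Real.norm_eq_abs, abs_le]
    constructor <;> nlinarith [Real.sin_le_one (a * v), Real.neg_one_le_sin (a * v),
      Real.cos_le_one (a * v), Real.neg_one_le_cos (a * v)]
  have hlim : Tendsto G atTop (𝓝 0) := by
    have := ((hosc.const_mul (1 / (a ^ 2 * (x ^ 2 + a ^ 2)))).sub
      (hvexp.const_mul (1 / (x * a)))).sub (hexp.const_mul (1 / (x ^ 2 * a)))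
    simp only [mul_zero, sub_zero] at this
    refine this.congr fun v => ?_
    simp only [hG]
    field_simp
    ring
  rw [integral_Ioi_of_hasDerivAt_of_tendsto' hderiv (integrableOn_ramp_mul_exp ha hx p) hlim]
  simp [hG]

lemma integral_Ioi_ramp_sub_mul_exp (a x u : ℝ) :
    ∫ w in Ioi (0 : ℝ), ramp a (w - u) * Real.exp (-(x * w)) =
      Real.exp (-(x * u)) * ∫ v in Ioi (max (-u) 0), ramp a v * Real.exp (-(x * v)) := by
  have h1 := (measurePreserving_sub_right volume u).setIntegral_preimage_emb
    (MeasurableEquiv.subRight u).measurableEmbedding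
    (fun v => Real.exp (-(x * u)) * (ramp a v * Real.exp (-(x * v)))) (Ioi (-u))
  have h2 : (fun w : ℝ => w - u) ⁻¹' Ioi (-u) = Ioi 0 := by ext w; simp
  rw [h2] at h1
  -- The range `(-u, ∞)` left by the shift can be cut at `0`, where the ramp starts.
  have h3 : ∫ v in Ioi (max (-u) 0), ramp a v * Real.exp (-(x * v)) =
      ∫ v in Ioi (-u), ramp a v * Real.exp (-(x * v)) := by
    refine (setIntegral_eq_of_subset_of_forall_sdiff_eq_zero measurableSet_Ioi
      (Ioi_subset_Ioi (le_max_left _ _)) fun v hv => ?_).symm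
    have : v ≤ 0 := by
      by_contra! h0
      exact hv.2 (max_lt hv.1 h0)
    rw [ramp_of_nonpos a this, zero_mul]
  rw [h3, ← integral_const_mul, ← h1]
  congr 1; ext w
  rw [mul_left_comm, ← Real.exp_add]
  congr 2; ring

/-- The symmetrized kernel inequality for positive arguments. -/
lemma symm_kernel_nonneg (ha : 0 < a) {x : ℝ} (hx : 0 < x) (u : ℝ) :
    (∫ w in Ioi (0 : ℝ), ramp a (w - u) * Real.exp (-(x * w))) +
      (∫ w in Ioi (0 : ℝ), ramp a (w - -u) * Real.exp (-(x * w))) ≤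
      (ramp a (-u) + ramp a u) / x + 2 / (a * x ^ 2) := by
  wlog hu : 0 ≤ u generalizing u
  · have := this (-u) (by linarith)
    rwa [neg_neg, add_comm, add_comm (ramp a u)] at this
  rw [integral_Ioi_ramp_sub_mul_exp, integral_Ioi_ramp_sub_mul_exp, neg_neg,
    max_eq_right (by linarith), max_eq_left hu, integral_Ioi_ramp_mul_exp ha hx le_rfl,
    integral_Ioi_ramp_mul_exp ha hx hu, ramp_of_nonpos a (by linarith : -u ≤ 0),
    ramp_of_nonneg a hu]
  have h1 : Real.exp (-(x * -u)) * (Real.exp (-(x * u)) * ((u / x + 1 / x ^ 2) / a -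
        (x * Real.sin (a * u) + a * Real.cos (a * u)) / (a ^ 2 * (x ^ 2 + a ^ 2)))) =
      (u / x + 1 / x ^ 2) / a -
        (x * Real.sin (a * u) + a * Real.cos (a * u)) / (a ^ 2 * (x ^ 2 + a ^ 2)) := by
    rw [← mul_assoc, ← Real.exp_add]; simp
  rw [h1]
  -- In the variables `y = x / a`, `θ = a u`, the difference of the two sides is the elementary
  -- expression times `a / (x² (x² + a²))`.
  have key := one_sub_exp_add_cos_sub_sin_nonneg (y := x / a) (θ := a * u) (by positivity)
    (by positivity)
  rw [show x / a * (a * u) = x * u by field_simp] at key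
  have hx2 : x ^ 2 + a ^ 2 ≠ 0 := by positivity
  simp only [mul_zero, neg_zero, Real.exp_zero, Real.sin_zero, Real.cos_zero, zero_div, zero_add,
    one_mul, mul_one]
  rw [← sub_nonneg]
  have e : (u - Real.sin (a * u) / a) / a / x + 2 / (a * x ^ 2) -
      (Real.exp (-(x * u)) * (1 / x ^ 2 / a - a / (a ^ 2 * (x ^ 2 + a ^ 2))) +
      ((u / x + 1 / x ^ 2) / a -
        (x * Real.sin (a * u) + a * Real.cos (a * u)) / (a ^ 2 * (x ^ 2 + a ^ 2)))) =
      (1 - Real.exp (-(x * u)) + (x / a) ^ 2 * (1 + Real.cos (a * u)) -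
        x / a * Real.sin (a * u)) * (a / (x ^ 2 * (x ^ 2 + a ^ 2))) := by
    field_simp
    ring
  rw [e]
  exact mul_nonneg key (by positivity)

/-- The symmetrized kernel inequality for negative arguments. -/
lemma symm_ramp_sub_le (ha : 0 < a) {w : ℝ} (hw : w ≤ 0) (u : ℝ) :
    (ramp a (-u) - ramp a (w - u)) + (ramp a u - ramp a (w + u)) ≤ 2 / a * -w := by
  wlog hu : 0 ≤ u generalizing u
  · have := this (-u) (by linarith)
    rw [neg_neg, sub_neg_eq_add, ← sub_eq_add_neg] at this
    linarith
  -- Only one of the two reflected terms survives, so the slope bound `2 / a` is spent once for the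
  -- pair: `1 / a` on average.
  rw [ramp_of_nonpos a (by linarith : -u ≤ 0), ramp_of_nonpos a (by linarith : w - u ≤ 0)]
  have := ramp_sub_le ha (by linarith : w + u ≤ u)
  calc _ = ramp a u - ramp a (w + u) := by ring
    _ ≤ _ := this
    _ = _ := by ring

end Ramp

/-! ### Integrating the kernel inequalities against an even density. -/

section Density

variable {a c K : ℝ} {φ : ℝ → ℝ}

lemma integrable_mul_ramp (ha : 0 < a) (hc : 0 < c) (hcont : Continuous φ) (hnn : ∀ t, 0 ≤ φ t)
    (hK : ∀ t, φ t ≤ K * Real.exp (c * t)) (w : ℝ) :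
    Integrable fun u => φ u * ramp a (w - u) := by
  have hK0 : 0 ≤ K := by simpa using (hnn 0).trans (hK 0)
  rw [← integrableOn_univ, ← Iic_union_Ioi (a := w)]
  refine IntegrableOn.union ?_ ?_
  -- Bounding the ramp at rate `c / 2`, half that of `φ`, leaves a factor `e^{cu/2}`, integrable at
  -- `-∞`. For `u > w` the ramp vanishes.
  · refine Integrable.mono' ((integrableOn_exp_mul_Iic (a := c / 2) (by linarith) w).const_mul
      (K * (2 / (a * (c / 2))) * Real.exp (c / 2 * w))) (by fun_prop) (ae_of_all _ fun u => ?_)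
    rw [Real.norm_of_nonneg (mul_nonneg (hnn u) (ramp_nonneg ha _))]
    calc _ ≤ (K * Real.exp (c * u)) * (2 / (a * (c / 2)) * Real.exp (c / 2 * (w - u))) := by
          gcongr
          · exact ramp_nonneg ha _
          · exact hK u
          · exact ramp_le_exp ha (by linarith) _
      _ = K * (2 / (a * (c / 2))) * (Real.exp (c * u) * Real.exp (c / 2 * (w - u))) := by ring
      _ = K * (2 / (a * (c / 2))) * (Real.exp (c / 2 * w) * Real.exp (c / 2 * u)) := by
          rw [← Real.exp_add, ← Real.exp_add]; congr 2; ring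
      _ = _ := by ring
  · refine integrableOn_zero.congr_fun (fun u hu => ?_) measurableSet_Ioi
    rw [ramp_of_nonpos a (by linarith [mem_Ioi.1 hu]), mul_zero]

/-- Since `φ` is even, reflecting `u` leaves each integral unchanged, so only the even parts of `f`
and `g` matter. The pointwise inequality without symmetrization is not available for the ramp kernel
with positive arguments. -/
lemma integral_le_of_symm_le (hφ : ∀ t, φ (-t) = φ t) (hnn : ∀ t, 0 ≤ φ t) {f g : ℝ → ℝ}
    (hf : Integrable fun u => φ u * f u) (hg : Integrable fun u => φ u * g u)
    (hfg : ∀ u, f u + f (-u) ≤ g u + g (-u)) : ∫ u, φ u * f u ≤ ∫ u, φ u * g u := by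
  have hsymm : ∀ k : ℝ → ℝ, ∫ u, φ u * k (-u) = ∫ u, φ u * k u := fun k => by
    rw [← integral_neg_eq_self fun u => φ u * k u]
    simp only [hφ]
  have hint : ∀ {k : ℝ → ℝ}, (Integrable fun u => φ u * k u) →
      Integrable fun u => φ u * k (-u) := fun hk => by simpa only [hφ] using hk.comp_neg
  have h := integral_mono (hf.add (hint hf)) (hg.add (hint hg)) fun u => by
    have := mul_le_mul_of_nonneg_left (hfg u) (hnn u)
    simp only [Pi.add_apply]
    linarith
  simp only [Pi.add_apply] at h
  rw [integral_add hf (hint hf), integral_add hg (hint hg), hsymm, hsymm] at h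
  linarith

lemma integral_ramp_sub_mul_exp_le (ha : 0 < a) (hc : 0 < c) (hcont : Continuous φ)
    (hφ : ∀ t, φ (-t) = φ t) (hnn : ∀ t, 0 ≤ φ t) (hK : ∀ t, φ t ≤ K * Real.exp (c * t))
    (hint : Integrable φ) {x : ℝ} (hx : 0 < x)
    (hi : IntegrableOn (fun w => (∫ u, φ u * ramp a (w - u)) * Real.exp (-(x * w))) (Ioi 0)) :
    ∫ w in Ioi (0 : ℝ), (∫ u, φ u * ramp a (w - u)) * Real.exp (-(x * w)) ≤
      (∫ u, φ u * ramp a (0 - u)) / x + (∫ u, φ u) / (a * x ^ 2) := by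
  have hI := integrable_mul_ramp ha hc hcont hnn hK
  -- The integrand is nonnegative, so the norm integrals over `u` are exactly the function assumed
  -- integrable in `hi`.
  have hprod : Integrable (fun p : ℝ × ℝ => φ p.1 * (ramp a (p.2 - p.1) * Real.exp (-(x * p.2))))
      (volume.prod (volume.restrict (Ioi (0 : ℝ)))) := by
    rw [integrable_prod_iff' (Continuous.aestronglyMeasurable (by fun_prop))]
    constructor
    · refine ae_of_all _ fun w => ?_
      simpa only [mul_assoc] using (hI w).mul_const (Real.exp (-(x * w)))
    · refine hi.congr (ae_of_all _ fun w => ?_)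
      simp only
      rw [← integral_mul_const]
      congr 1; ext u
      rw [Real.norm_of_nonneg (mul_nonneg (hnn u)
        (mul_nonneg (ramp_nonneg ha _) (Real.exp_nonneg _))), mul_assoc]
  have hswap : ∫ w in Ioi (0 : ℝ), (∫ u, φ u * ramp a (w - u)) * Real.exp (-(x * w)) =
      ∫ u, φ u * ∫ w in Ioi (0 : ℝ), ramp a (w - u) * Real.exp (-(x * w)) := by
    simp_rw [← integral_const_mul (φ _)]
    rw [integral_integral_swap hprod]
    congr 1; ext w
    rw [← integral_mul_const]
    simp only [mul_assoc]
  have hJ : Integrable fun u => φ u * ∫ w in Ioi (0 : ℝ), ramp a (w - u) * Real.exp (-(x * w)) := by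
    simpa only [integral_const_mul] using hprod.integral_prod_left
  have hR1 := (hI 0).div_const x
  have hR2 := hint.div_const (a * x ^ 2)
  have hR : ∫ u, φ u * (ramp a (0 - u) / x + 1 / (a * x ^ 2)) =
      (∫ u, φ u * ramp a (0 - u)) / x + (∫ u, φ u) / (a * x ^ 2) := by
    rw [← integral_div, ← integral_div, ← integral_add hR1 hR2]
    congr 1; ext u; ring
  rw [hswap, ← hR]
  refine integral_le_of_symm_le hφ hnn hJ ((hR1.add hR2).congr (ae_of_all _ fun u => ?_))
    fun u => ?_
  · simp only [Pi.add_apply]; ring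
  · refine (symm_kernel_nonneg ha hx u).trans (le_of_eq ?_)
    rw [zero_sub, zero_sub, neg_neg]; ring

/-- On the negative half line `H` stays above an affine function of slope `(∫ φ) / a`; this
comparison yields the sign for `x < 0`. -/
lemma le_integral_ramp_sub (ha : 0 < a) (hc : 0 < c) (hcont : Continuous φ)
    (hφ : ∀ t, φ (-t) = φ t) (hnn : ∀ t, 0 ≤ φ t) (hK : ∀ t, φ t ≤ K * Real.exp (c * t))
    (hint : Integrable φ) {w : ℝ} (hw : w ≤ 0) :
    (∫ u, φ u * ramp a (0 - u)) + (∫ u, φ u) / a * w ≤ ∫ u, φ u * ramp a (w - u) := by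
  have hI := integrable_mul_ramp ha hc hcont hnn hK
  have h := integral_le_of_symm_le hφ hnn (f := fun u => ramp a (0 - u) - ramp a (w - u))
    (g := fun _ => 1 / a * -w) (((hI 0).sub (hI w)).congr
      (ae_of_all _ fun u => (mul_sub _ _ _).symm))
    (hint.mul_const _) fun u => by
      have := symm_ramp_sub_le ha hw u
      rw [zero_sub, zero_sub, neg_neg, sub_neg_eq_add]
      calc _ ≤ _ := this
        _ = _ := by ring
  simp only [mul_sub] at h
  rw [integral_sub (hI 0) (hI w), integral_mul_const] at h
  have e : (∫ u, φ u) * (1 / a * -w) = -((∫ u, φ u) / a * w) := by ring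
  linarith

end Density

/-! ### Laplace transforms of the sine, linear and ramp kernels. -/

section Kernels

lemma integrableOn_id_mul_exp {s : ℂ} (hs : 0 < s.re) :
    IntegrableOn (fun v : ℝ => (v : ℂ) * Complex.exp (-s * v)) (Ioi 0) := by
  refine Integrable.mono' ((integrableOn_exp_mul_Ioi (a := -(s.re / 2)) (by linarith) 0).const_mul
    (2 / s.re)) (by fun_prop) (ae_restrict_of_forall_mem measurableSet_Ioi fun v hv => ?_)
  rw [mem_Ioi] at hv
  have h1 : v ≤ 2 / s.re * Real.exp (s.re / 2 * v) := by
    have := Real.add_one_le_exp (s.re / 2 * v)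
    calc v = 2 / s.re * (s.re / 2 * v) := by field_simp
      _ ≤ _ := by gcongr; linarith
  rw [norm_mul, Complex.norm_exp, Complex.norm_real, Real.norm_of_nonneg hv.le]
  calc _ ≤ 2 / s.re * Real.exp (s.re / 2 * v) * Real.exp ((-s * (v : ℂ)).re) := by gcongr
    _ = _ := by
        rw [mul_assoc, ← Real.exp_add]; congr 2
        simp only [neg_mul, Complex.neg_re, Complex.re_mul_ofReal]; ring

lemma integral_Ioi_id_mul_exp {s : ℂ} (hs : 0 < s.re) :
    ∫ v in Ioi (0 : ℝ), (v : ℂ) * Complex.exp (-s * v) = 1 / s ^ 2 := by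
  have hs0 : s ≠ 0 := fun h => by simp [h] at hs
  have hderiv : ∀ v ∈ Ici (0 : ℝ), HasDerivAt
      (fun v : ℝ => -(((v : ℂ) / s + 1 / s ^ 2) * Complex.exp (-s * v)))
      ((v : ℂ) * Complex.exp (-s * v)) v := by
    intro v _
    have h0 : HasDerivAt (fun v : ℝ => (v : ℂ)) 1 v := Complex.ofRealCLM.hasDerivAt
    have := (((h0.div_const s).add_const (1 / s ^ 2)).mul (h0.const_mul (-s)).cexp).neg
    refine this.congr_deriv ?_
    field_simp
    ring
  have hnorm : ∀ v : ℝ, ‖Complex.exp (-s * v)‖ = Real.exp (-s.re * v) := fun v => by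
    rw [Complex.norm_exp]; simp
  have h1 : Tendsto (fun v : ℝ => (v : ℂ) * Complex.exp (-s * v)) atTop (𝓝 0) := by
    have := tendsto_rpow_mul_exp_neg_mul_atTop_nhds_zero 1 s.re hs
    refine tendsto_zero_iff_norm_tendsto_zero.2 (this.congr' ?_)
    filter_upwards [eventually_ge_atTop 0] with v hv
    rw [norm_mul, hnorm, Complex.norm_real, Real.norm_of_nonneg hv, Real.rpow_one]
  have h2 : Tendsto (fun v : ℝ => Complex.exp (-s * v)) atTop (𝓝 0) := by
    refine tendsto_zero_iff_norm_tendsto_zero.2 ?_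
    simp only [hnorm]
    simpa using tendsto_rpow_mul_exp_neg_mul_atTop_nhds_zero 0 s.re hs
  have hlim : Tendsto (fun v : ℝ => -(((v : ℂ) / s + 1 / s ^ 2) * Complex.exp (-s * v))) atTop
      (𝓝 0) := by
    have := ((h1.const_mul (1 / s)).add (h2.const_mul (1 / s ^ 2))).neg
    simp only [mul_zero, add_zero, neg_zero] at this
    refine this.congr fun v => ?_
    ring
  rw [integral_Ioi_of_hasDerivAt_of_tendsto' hderiv (integrableOn_id_mul_exp hs) hlim]
  simp

lemma integral_Ioi_exp_neg_mul {s : ℂ} (hs : 0 < s.re) :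
    ∫ v in Ioi (0 : ℝ), Complex.exp (-s * v) = 1 / s := by
  rw [integral_exp_mul_complex_Ioi (by simpa using hs)]
  simp [neg_div_neg_eq]

lemma integrableOn_exp_neg_mul {s : ℂ} (hs : 0 < s.re) :
    IntegrableOn (fun v : ℝ => Complex.exp (-s * v)) (Ioi 0) :=
  integrableOn_exp_mul_complex_Ioi (by simpa using hs) 0

variable (a : ℝ)

lemma sin_mul_exp_eq (s : ℂ) (v : ℝ) : (Real.sin (a * v) : ℂ) * Complex.exp (-s * v) =
    Complex.I / 2 * (Complex.exp (-(s + a * Complex.I) * v) -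
      Complex.exp (-(s - a * Complex.I) * v)) := by
  rw [Complex.ofReal_sin, Complex.sin]
  have h1 : Complex.exp (-(s + a * Complex.I) * v) =
      Complex.exp (-((a * v : ℝ) : ℂ) * Complex.I) * Complex.exp (-s * v) := by
    rw [← Complex.exp_add]; congr 1; push_cast; ring
  have h2 : Complex.exp (-(s - a * Complex.I) * v) =
      Complex.exp (((a * v : ℝ) : ℂ) * Complex.I) * Complex.exp (-s * v) := by
    rw [← Complex.exp_add]; congr 1; push_cast; ring
  rw [h1, h2]; ring

lemma integrableOn_sin_mul_exp {s : ℂ} (hs : 0 < s.re) :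
    IntegrableOn (fun v : ℝ => (Real.sin (a * v) : ℂ) * Complex.exp (-s * v)) (Ioi 0) := by
  simp only [sin_mul_exp_eq]
  exact ((integrableOn_exp_neg_mul (by simpa using hs)).sub
    (integrableOn_exp_neg_mul (by simpa using hs))).const_mul _

lemma sq_add_sq_factor (s : ℂ) :
    s ^ 2 + (a : ℂ) ^ 2 = (s + a * Complex.I) * (s - a * Complex.I) := by
  ring_nf; rw [Complex.I_sq]; ring

lemma sq_add_sq_ne_zero {s : ℂ} (hs : 0 < s.re) : s ^ 2 + (a : ℂ) ^ 2 ≠ 0 := by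
  rw [sq_add_sq_factor]
  refine mul_ne_zero (fun h => ?_) fun h => ?_ <;>
  · have := congrArg Complex.re h
    simp at this
    linarith

lemma integral_Ioi_sin_mul_exp {s : ℂ} (hs : 0 < s.re) :
    ∫ v in Ioi (0 : ℝ), (Real.sin (a * v) : ℂ) * Complex.exp (-s * v) =
      a / (s ^ 2 + (a : ℂ) ^ 2) := by
  have h1 : 0 < (s + a * Complex.I).re := by simpa using hs
  have h2 : 0 < (s - a * Complex.I).re := by simpa using hs
  simp only [sin_mul_exp_eq]
  rw [integral_const_mul, integral_sub (integrableOn_exp_neg_mul h1) (integrableOn_exp_neg_mul h2),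
    integral_Ioi_exp_neg_mul h1, integral_Ioi_exp_neg_mul h2, sq_add_sq_factor]
  have h3 : s + a * Complex.I ≠ 0 := fun h => by simp [h] at h1
  have h4 : s - a * Complex.I ≠ 0 := fun h => by simp [h] at h2
  rw [div_sub_div _ _ h3 h4, div_mul_div_comm, div_eq_div_iff (by positivity) (by positivity)]
  linear_combination (-2 * a * (s + a * Complex.I) * (s - a * Complex.I)) * Complex.I_sq

variable {a}

lemma ramp_mul_exp_eq (s : ℂ) {v : ℝ} (hv : 0 < v) :
    (ramp a v : ℂ) * Complex.exp (-s * v) = 1 / a * ((v : ℂ) * Complex.exp (-s * v)) -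
      1 / a ^ 2 * ((Real.sin (a * v) : ℂ) * Complex.exp (-s * v)) := by
  rw [ramp_of_nonneg a hv.le]; push_cast; ring

lemma integrableOn_ramp_mul_cexp {s : ℂ} (hs : 0 < s.re) :
    IntegrableOn (fun v : ℝ => (ramp a v : ℂ) * Complex.exp (-s * v)) (Ioi 0) :=
  IntegrableOn.congr_fun (((integrableOn_id_mul_exp hs).const_mul (1 / (a : ℂ))).sub
    ((integrableOn_sin_mul_exp a hs).const_mul (1 / (a : ℂ) ^ 2)))
    (fun _ hv => (ramp_mul_exp_eq s hv).symm) measurableSet_Ioi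

lemma integral_Ioi_ramp_mul_cexp (ha : 0 < a) {s : ℂ} (hs : 0 < s.re) :
    ∫ v in Ioi (0 : ℝ), (ramp a v : ℂ) * Complex.exp (-s * v) =
      a / (s ^ 2 * (s ^ 2 + (a : ℂ) ^ 2)) := by
  rw [setIntegral_congr_fun measurableSet_Ioi fun v hv => ramp_mul_exp_eq s hv,
    integral_sub ((integrableOn_id_mul_exp hs).const_mul _)
      ((integrableOn_sin_mul_exp a hs).const_mul _), integral_const_mul, integral_const_mul,
    integral_Ioi_id_mul_exp hs, integral_Ioi_sin_mul_exp a hs]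
  have h1 : s ≠ 0 := fun h => by simp [h] at hs
  have h2 := sq_add_sq_ne_zero a hs
  have h3 : (a : ℂ) ≠ 0 := by exact_mod_cast ha.ne'
  field_simp
  ring

end Kernels

/-! ### Holomorphy of half-line Laplace integrals. -/

section Holomorphic

variable {f : ℝ → ℂ} {K d : ℝ}

lemma differentiableAt_integral_Iic (hf : Continuous f)
    (hK : ∀ t, ‖f t‖ ≤ K * Real.exp (d * t)) {z₀ : ℂ} (hz : z₀.re < d) :
    DifferentiableAt ℂ (fun z : ℂ => ∫ w in Iic (0 : ℝ), f w * Complex.exp (-z * (w : ℂ))) z₀ := by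
  obtain ⟨e, he1, he2⟩ := exists_between hz
  -- Half of the gap `δ` in the exponential rate absorbs the factor `|w|` produced by
  -- differentiating; the other half gives integrability.
  set δ := d - e with hδ
  have hδ0 : 0 < δ := by linarith
  have hK0 : 0 ≤ K := by simpa using (norm_nonneg _).trans (hK 0)
  refine (hasDerivAt_integral_of_dominated_loc_of_deriv_le (𝕜 := ℂ)
    (F := fun (z : ℂ) (w : ℝ) => f w * Complex.exp (-z * (w : ℂ)))
    (F' := fun (z : ℂ) (w : ℝ) => f w * (Complex.exp (-z * (w : ℂ)) * -w))
    (bound := fun w : ℝ => K * (2 / δ) * Real.exp (δ / 2 * w))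
    (s := {z : ℂ | z.re < e}) ?_ (Eventually.of_forall fun z => ?_)
    (integrableOn_exp_bound_Iic hf hK hz) ?_ ?_ ?_ ?_).2.differentiableAt
  · exact (isOpen_lt Complex.continuous_re continuous_const).mem_nhds he1
  · exact Continuous.aestronglyMeasurable (by fun_prop)
  · exact Continuous.aestronglyMeasurable (by fun_prop)
  · refine ae_restrict_of_forall_mem measurableSet_Iic fun w hw z hz => ?_
    rw [mem_Iic] at hw
    have h1 : -w ≤ 2 / δ * Real.exp (-(δ / 2 * w)) := by
      have := Real.add_one_le_exp (-(δ / 2 * w))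
      calc -w = 2 / δ * (-(δ / 2 * w)) := by field_simp
        _ ≤ _ := by gcongr; linarith
    rw [norm_mul, norm_mul, Complex.norm_exp, norm_neg, Complex.norm_real, Real.norm_of_nonpos hw]
    have h2 : (-z * (w : ℂ)).re ≤ -(e * w) := by
      have : z.re < e := hz
      simp only [neg_mul, Complex.neg_re, Complex.re_mul_ofReal]
      nlinarith
    calc _ ≤ (K * Real.exp (d * w)) *
          (Real.exp (-(e * w)) * (2 / δ * Real.exp (-(δ / 2 * w)))) := by
          refine mul_le_mul (hK w) (mul_le_mul (Real.exp_le_exp.2 h2) h1 (by linarith)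
            (Real.exp_nonneg _)) (mul_nonneg (Real.exp_nonneg _) (by linarith)) (by positivity)
      _ = K * (2 / δ) * (Real.exp (d * w) * Real.exp (-(e * w)) * Real.exp (-(δ / 2 * w))) := by
          ring
      _ = _ := by
          rw [← Real.exp_add, ← Real.exp_add]; congr 2; rw [hδ]; ring
  · exact (integrableOn_exp_mul_Iic (by linarith) 0).const_mul _
  · refine ae_of_all _ fun w z _ => ?_
    have : HasDerivAt (fun z : ℂ => -z * (w : ℂ)) (-(w : ℂ)) z := by
      simpa using (hasDerivAt_id z).neg.mul_const (w : ℂ)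
    exact this.cexp.const_mul _

lemma differentiableAt_integral_Ici (hf : Continuous f)
    (hK : ∀ t, ‖f t‖ ≤ K * Real.exp (d * t)) {z₀ : ℂ} (hz : d < z₀.re) :
    DifferentiableAt ℂ (fun z : ℂ => ∫ w in Ici (0 : ℝ), f w * Complex.exp (-z * (w : ℂ))) z₀ := by
  have h := differentiableAt_integral_Iic (f := fun w => f (-w)) (K := K) (d := -d) (z₀ := -z₀)
    (by fun_prop) (fun t => by simpa using hK (-t)) (by simpa using hz)
  have h2 := h.comp z₀ (f := fun z : ℂ => -z) (by fun_prop)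
  refine h2.congr_of_eventuallyEq (Eventually.of_forall fun z => ?_)
  have := integral_comp_neg_Iic 0 (fun w : ℝ => f w * Complex.exp (-z * (w : ℂ)))
  rw [neg_zero] at this
  simp only [Function.comp_apply, integral_Ici_eq_integral_Ioi, ← this]
  congr 1; ext w
  push_cast
  simp

end Holomorphic

namespace StripDecay

variable {ψ : ℂ → ℂ} {α β : ℝ}

lemma differentiableAt_integral_Iic (hψ : StripDecay ψ α β) {c : ℝ} (hc : c ∈ Ioo α β) {z₀ : ℂ}
    (hz : z₀.re < β) : DifferentiableAt ℂ
      (fun z : ℂ => ∫ w in Iic (0 : ℝ), lineInv ψ c w * Complex.exp (-z * (w : ℂ))) z₀ := by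
  obtain ⟨d, hd1, hd2⟩ := exists_between (max_lt hz (hc.1.trans hc.2))
  obtain ⟨K, -, hK⟩ := hψ.exists_bound hc ⟨(le_max_right _ _).trans_lt hd1, hd2⟩
  exact LPInterp.differentiableAt_integral_Iic (hψ.continuous_lineInv hc) hK
    ((le_max_left _ _).trans_lt hd1)

lemma differentiableAt_integral_Ici (hψ : StripDecay ψ α β) {c : ℝ} (hc : c ∈ Ioo α β) {z₀ : ℂ}
    (hz : α < z₀.re) : DifferentiableAt ℂ
      (fun z : ℂ => ∫ w in Ici (0 : ℝ), lineInv ψ c w * Complex.exp (-z * (w : ℂ))) z₀ := by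
  obtain ⟨d, hd1, hd2⟩ := exists_between (lt_min hz (hc.1.trans hc.2))
  obtain ⟨K, -, hK⟩ := hψ.exists_bound hc ⟨hd1, hd2.trans_le (min_le_right _ _)⟩
  exact LPInterp.differentiableAt_integral_Ici (hψ.continuous_lineInv hc) hK
    (hd2.trans_le (min_le_left _ _))

/-- Convolution with a kernel on the half line multiplies the transform by the Laplace transform
of the kernel. -/
lemma integral_Ioi_mul_lineInv_sub (hψ : StripDecay ψ α β) {c : ℝ} (hc : c ∈ Ioo α β)
    (hc0 : 0 < c) {κ : ℝ → ℂ} {L : ℂ → ℂ}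
    (hκ : ∀ s : ℂ, 0 < s.re → IntegrableOn (fun v : ℝ => κ v * Complex.exp (-s * v)) (Ioi 0))
    (hL : ∀ s : ℂ, 0 < s.re → ∫ v in Ioi (0 : ℝ), κ v * Complex.exp (-s * v) = L s) (t : ℝ) :
    ∫ v in Ioi (0 : ℝ), κ v * lineInv ψ c (t - v) = lineInv (fun s => ψ s * L s) c t :=
  integral_mul_lineInv_sub (hψ.integrable_line hc) measurable_id
    (hκ c (by simpa using hc0)) (fun u => by rw [← hL _ (by simpa using hc0)]; rfl) t

end StripDecay

/-! ### Expressing `g`, `h_a`, `A` and `M⁺` through the density. -/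

namespace EvenQuotient

variable {F E : ℂ → ℂ} {τ a : ℝ}

lemma half_mem (D : EvenQuotient E τ) : τ / 2 ∈ Ioo 0 τ :=
  ⟨by linarith [D.τ_pos], by linarith [D.τ_pos]⟩

lemma half_mem' (D : EvenQuotient E τ) : τ / 2 ∈ Ioo (-τ) τ :=
  ⟨by linarith [D.τ_pos], by linarith [D.τ_pos]⟩

lemma stripDecay_inv_right (D : EvenQuotient E τ) : StripDecay (fun s => (E s)⁻¹) 0 τ :=
  D.stripDecay_inv.mono (by linarith [D.τ_pos]) le_rfl

lemma ne_zero_of_mem_strip {α β : ℝ} (hα : 0 ≤ α) {z : ℂ} (hz : z ∈ Complex.re ⁻¹' Ioo α β) :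
    z ≠ 0 := by
  rintro rfl
  exact absurd hz.1 (by simpa using hα)

lemma norm_ge_of_re_ge {c : ℝ} {z : ℂ} (hz : c ≤ z.re) : c ≤ ‖z‖ :=
  hz.trans ((le_abs_self _).trans (Complex.abs_re_le_norm z))

/-- Here `s / F(s) = 1 / (s E(s))`, and `1 / s` is bounded on closed substrips of `0 < Re s`. This
decay permits differentiating `g` under the integral. -/
lemma stripDecay_mul_inv (D : EvenQuotient E τ) (hF : ∀ z, F z = z ^ 2 * E z) :
    StripDecay (fun s => s * (F s)⁻¹) 0 τ := by
  have h := D.stripDecay_inv_right.mul_bounded (χ := fun s => s⁻¹)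
    (fun z hz => (differentiableAt_inv (ne_zero_of_mem_strip le_rfl hz)).differentiableWithinAt)
    (fun c₁ c₂ h1 _ _ => ⟨c₁⁻¹, fun z hz => by
      rw [norm_inv]
      have := norm_ge_of_re_ge hz.1
      gcongr⟩)
  convert! h using 2 with s
  rw [hF]
  rcases eq_or_ne s 0 with rfl | hs
  · simp
  · rw [mul_inv, ← mul_assoc, pow_two, mul_inv, mul_inv_cancel_left₀ hs, mul_comm]

lemma stripDecay_inv_F (D : EvenQuotient E τ) (hF : ∀ z, F z = z ^ 2 * E z) :
    StripDecay (fun s => (F s)⁻¹) 0 τ := by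
  have h := D.stripDecay_inv_right.mul_bounded (χ := fun s => (s ^ 2)⁻¹)
    (fun z hz => ((differentiableAt_id.pow 2).inv
      (pow_ne_zero 2 (ne_zero_of_mem_strip le_rfl hz))).differentiableWithinAt)
    (fun c₁ c₂ h1 _ _ => ⟨(c₁ ^ 2)⁻¹, fun z hz => by
      rw [norm_inv, norm_pow]
      have := norm_ge_of_re_ge hz.1
      gcongr⟩)
  convert! h using 2 with s
  rw [hF, mul_inv, mul_comm]

lemma stripDecay_h (D : EvenQuotient E τ) (hF : ∀ z, F z = z ^ 2 * E z) (a : ℝ) :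
    StripDecay (fun s => (F s)⁻¹ * (a / (s ^ 2 + (a : ℂ) ^ 2))) 0 τ := by
  refine (D.stripDecay_inv_F hF).mul_bounded (χ := fun s => (a : ℂ) / (s ^ 2 + (a : ℂ) ^ 2)) ?_ ?_
  · exact DifferentiableOn.div (by fun_prop) (by fun_prop) fun z hz => sq_add_sq_ne_zero a hz.1
  · refine fun c₁ c₂ h1 _ _ => ⟨|a| / (c₁ * c₁), fun z hz => ?_⟩
    rw [norm_div, sq_add_sq_factor, norm_mul, Complex.norm_real, Real.norm_eq_abs]
    have e1 : c₁ ≤ ‖z + a * Complex.I‖ := norm_ge_of_re_ge (by simpa using hz.1)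
    have e2 : c₁ ≤ ‖z - a * Complex.I‖ := norm_ge_of_re_ge (by simpa using hz.1)
    gcongr

lemma g_eq_lineInv (F : ℂ → ℂ) (c : ℝ) : g F c = lineInv (fun s => (F s)⁻¹) c := by
  ext t
  simp only [g, gIntegrand, lineInv, div_eq_mul_inv]

/-- After `l ↦ -l`, `h_a` is the convolution of `g` with the sine on the half line, whose Laplace
transform is `a / (s² + a²)`. -/
lemma h_eq_lineInv (D : EvenQuotient E τ) (hF : ∀ z, F z = z ^ 2 * E z) (a : ℝ) :
    h F τ a = lineInv (fun s => (F s)⁻¹ * (a / (s ^ 2 + (a : ℂ) ^ 2))) (τ / 2) := by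
  ext w
  rw [← (D.stripDecay_inv_F hF).integral_Ioi_mul_lineInv_sub D.half_mem D.half_mem.1
    (κ := fun v => (Real.sin (a * v) : ℂ)) (L := fun s => a / (s ^ 2 + (a : ℂ) ^ 2))
    (fun s hs => integrableOn_sin_mul_exp a hs) (fun s hs => integral_Ioi_sin_mul_exp a hs),
    h, g_eq_lineInv, ← integral_neg]
  have := integral_comp_neg_Iic 0 fun v : ℝ =>
    (Real.sin (a * v) : ℂ) * lineInv (fun s => (F s)⁻¹) (τ / 2) (w - v)
  rw [neg_zero] at this
  rw [← this]
  congr 1; ext l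
  rw [mul_neg, Real.sin_neg, sub_neg_eq_add, add_comm w l]
  push_cast; ring

/-- The density with bilateral Laplace transform `1 / E`. -/
noncomputable def density (E : ℂ → ℂ) (t : ℝ) : ℝ := (lineInv (fun s => (E s)⁻¹) 0 t).re

lemma ofReal_density (D : EvenQuotient E τ) (t : ℝ) :
    (density E t : ℂ) = lineInv (fun s => (E s)⁻¹) 0 t := by
  have := Complex.le_def.1 (D.lineInv_inv_nonneg t)
  exact Complex.ext rfl (by simpa using this.2)

lemma density_nonneg (D : EvenQuotient E τ) (t : ℝ) : 0 ≤ density E t :=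
  (Complex.le_def.1 (D.lineInv_inv_nonneg t)).1

lemma density_neg (D : EvenQuotient E τ) (t : ℝ) : density E (-t) = density E t := by
  rw [density, density, D.lineInv_inv_neg]

lemma continuous_density (D : EvenQuotient E τ) : Continuous (density E) :=
  Complex.continuous_re.comp (D.stripDecay_inv.continuous_lineInv D.zero_mem)

lemma integrable_density (D : EvenQuotient E τ) : Integrable (density E) := by
  have := D.stripDecay_inv.integrable_lineInv_mul_exp D.zero_mem (z := 0) (by simpa using D.τ_pos)
    (by simpa using D.τ_pos)
  simp only [neg_zero, zero_mul, Complex.exp_zero, mul_one] at this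
  exact this.re

lemma exists_density_le (D : EvenQuotient E τ) :
    ∃ K, ∀ t, density E t ≤ K * Real.exp (τ / 2 * t) := by
  obtain ⟨K, -, hK⟩ := D.stripDecay_inv.exists_bound D.zero_mem D.half_mem'
  exact ⟨K, fun t => ((le_abs_self _).trans (Complex.abs_re_le_norm _)).trans (hK t)⟩

lemma ofReal_density_half (D : EvenQuotient E τ) (t : ℝ) :
    (density E t : ℂ) = lineInv (fun s => (E s)⁻¹) (τ / 2) t := by
  rw [D.ofReal_density, D.stripDecay_inv.lineInv_eq D.zero_mem D.half_mem']

/-- The double pole is moved from `1 / F` to the sine kernel: `s⁻² · a / (s² + a²)` is the transform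
of the ramp, and what remains is `1 / E`. This shows that `h_a` is real. -/
lemma h_eq_ofReal (D : EvenQuotient E τ) (hF : ∀ z, F z = z ^ 2 * E z) (ha : 0 < a) (w : ℝ) :
    h F τ a w = ((∫ u, density E u * ramp a (w - u) : ℝ) : ℂ) := by
  have h1 := D.stripDecay_inv_right.integral_Ioi_mul_lineInv_sub D.half_mem D.half_mem.1
    (κ := fun v => (ramp a v : ℂ)) (L := fun s => a / (s ^ 2 * (s ^ 2 + (a : ℂ) ^ 2)))
    (fun s hs => integrableOn_ramp_mul_cexp hs) (fun s hs => integral_Ioi_ramp_mul_cexp ha hs) w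
  have h2 : (fun s => (E s)⁻¹ * (a / (s ^ 2 * (s ^ 2 + (a : ℂ) ^ 2)))) =
      fun s => (F s)⁻¹ * (a / (s ^ 2 + (a : ℂ) ^ 2)) := by
    ext s
    rw [hF, mul_inv, div_eq_mul_inv, div_eq_mul_inv, mul_inv]; ring
  rw [h2, setIntegral_eq_integral_of_forall_compl_eq_zero fun v hv => by
    rw [ramp_of_nonpos a (not_lt.1 hv), Complex.ofReal_zero, zero_mul]] at h1
  rw [D.h_eq_lineInv hF, ← h1, ← integral_sub_left_eq_self _ volume w, ← integral_complex_ofReal]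
  congr 1; ext v
  rw [← D.ofReal_density_half, sub_sub_cancel]
  push_cast; ring

lemma hasDerivAt_g (D : EvenQuotient E τ) (hF : ∀ z, F z = z ^ 2 * E z) (t : ℝ) :
    HasDerivAt (g F (τ / 2)) (lineInv (fun s => s * (F s)⁻¹) (τ / 2) t) t := by
  rw [g_eq_lineInv]
  exact (D.stripDecay_inv_F hF).hasDerivAt_lineInv (D.stripDecay_mul_inv hF) D.half_mem t

/-- By symmetry of the density, half of its mass lies on the negative half line. -/
lemma two_mul_deriv_g_zero (D : EvenQuotient E τ) (hF : ∀ z, F z = z ^ 2 * E z) :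
    2 * deriv (g F (τ / 2)) 0 = ((∫ u, density E u : ℝ) : ℂ) := by
  have h1 := D.stripDecay_inv_right.integral_Ioi_mul_lineInv_sub D.half_mem D.half_mem.1
    (κ := fun v => 1) (L := fun s => 1 / s)
    (fun s hs => by simpa only [one_mul] using integrableOn_exp_neg_mul hs)
    (fun s hs => by simpa only [one_mul] using integral_Ioi_exp_neg_mul hs) 0
  have h2 : (fun s => (E s)⁻¹ * (1 / s)) = fun s => s * (F s)⁻¹ := by
    ext s
    rw [hF]
    rcases eq_or_ne s 0 with rfl | hs
    · simp
    · rw [mul_inv, pow_two, mul_inv]; field_simp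
  rw [h2] at h1
  have h3 : ∀ v, density E |v| = density E v := fun v => by
    rcases abs_choice v with h | h <;> rw [h]
    exact D.density_neg v
  rw [(D.hasDerivAt_g hF 0).deriv, ← h1]
  have h4 := integral_comp_abs (f := density E)
  simp only [h3] at h4
  rw [h4]
  push_cast
  rw [← integral_complex_ofReal]
  congr 2; ext v
  rw [one_mul, zero_sub, ← D.ofReal_density_half, D.density_neg]

lemma differentiable_F (D : EvenQuotient E τ) (hF : ∀ z, F z = z ^ 2 * E z) :
    Differentiable ℂ F := by
  have := D.differentiable
  rw [funext hF]
  fun_prop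

/-- The two half-line integrals add up to the bilateral transform of `h_a`, which inversion
identifies as `a / (F(z) (z² + a²))`; multiplication by `F(z) / a` gives the claim. -/
lemma A₁_eq_A₂ (D : EvenQuotient E τ) (hF : ∀ z, F z = z ^ 2 * E z) (ha : 0 < a) {z : ℂ}
    (h0 : 0 < z.re) (h1 : z.re < τ) : A₁ F τ a z = A₂ F τ a z := by
  have hd := D.stripDecay_h hF a
  have hinv := hd.integral_lineInv_mul_exp D.half_mem h0 h1
  have hsplit := intervalIntegral.integral_Iic_add_Ioi (b := (0 : ℝ))
    (hd.integrableOn_Iic D.half_mem h1)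
    ((hd.integrableOn_Ici D.half_mem h0).mono_set Ioi_subset_Ici_self)
  rw [hinv, ← integral_Ici_eq_integral_Ioi] at hsplit
  rw [A₁, A₂, D.h_eq_lineInv hF, eq_sub_iff_add_eq, ← mul_add, hsplit]
  have hz : z ≠ 0 := fun h => by simp [h] at h0
  have hFz : F z ≠ 0 := by
    rw [hF]
    exact mul_ne_zero (pow_ne_zero 2 hz)
      (D.ne_zero_of_abs_re_lt (abs_lt.2 ⟨by linarith, h1⟩))
  have ha' : (a : ℂ) ≠ 0 := by exact_mod_cast ha.ne'
  have := sq_add_sq_ne_zero a h0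
  field_simp

lemma wellDefined (D : EvenQuotient E τ) (hF : ∀ z, F z = z ^ 2 * E z) (ha : 0 < a) :
    WellDefined F τ a where
  integrable_g t := by
    have := (D.stripDecay_inv_F hF).integrable_exp_line D.half_mem t
    simp only [← div_eq_mul_inv] at this
    exact this
  differentiable_g t := (D.hasDerivAt_g hF t).differentiableAt
  integrable_h w := by
    obtain ⟨K, hK0, hK⟩ := (D.stripDecay_inv_F hF).exists_bound D.half_mem D.half_mem
    have hcont := (D.stripDecay_inv_F hF).continuous_lineInv D.half_mem
    rw [g_eq_lineInv]
    refine Integrable.mono' ((integrableOn_exp_mul_Iic D.half_mem.1 0).const_mul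
      (K * Real.exp (τ / 2 * w))) (by fun_prop) (ae_of_all _ fun l => ?_)
    rw [norm_mul, Complex.norm_real, Real.norm_eq_abs]
    calc _ ≤ K * Real.exp (τ / 2 * (l + w)) * 1 := by
          gcongr
          · exact hK _
          · exact Real.abs_sin_le_one _
      _ = _ := by rw [mul_add, Real.exp_add]; ring
  integrable_A₁ z hz := by
    rw [D.h_eq_lineInv hF]; exact (D.stripDecay_h hF a).integrableOn_Iic D.half_mem hz
  integrable_A₂ z hz := by
    rw [D.h_eq_lineInv hF]; exact (D.stripDecay_h hF a).integrableOn_Ici D.half_mem hz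
  A₁_eq_A₂ _ h0 h1 := D.A₁_eq_A₂ hF ha h0 h1

lemma A_eq_A₂ (D : EvenQuotient E τ) (hF : ∀ z, F z = z ^ 2 * E z) (ha : 0 < a) {z : ℂ}
    (h0 : 0 < z.re) : A F τ a z = A₂ F τ a z := by
  rw [A]
  split_ifs with h1
  · exact D.A₁_eq_A₂ hF ha h0 h1
  · rfl

lemma differentiable_A (D : EvenQuotient E τ) (hF : ∀ z, F z = z ^ 2 * E z) (ha : 0 < a) :
    Differentiable ℂ (A F τ a) := by
  intro z
  have hFd := D.differentiable_F hF z
  have hd := D.stripDecay_h hF a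
  have hτ := D.τ_pos
  rcases lt_or_ge z.re τ with h1 | h1
  · have : A F τ a =ᶠ[𝓝 z] A₁ F τ a := by
      filter_upwards [(isOpen_lt Complex.continuous_re continuous_const).mem_nhds h1] with y hy
      exact if_pos hy
    refine DifferentiableAt.congr_of_eventuallyEq ?_ this
    unfold A₁
    rw [D.h_eq_lineInv hF]
    exact (hFd.div_const _).mul (hd.differentiableAt_integral_Iic D.half_mem h1)
  -- On the seam `Re z = τ` a neighbourhood meets both branches, but there `A` agrees with `A₂`
  -- throughout `Re z > 0`.
  · have h0 : 0 < z.re := hτ.trans_le h1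
    have : A F τ a =ᶠ[𝓝 z] A₂ F τ a := by
      filter_upwards [(isOpen_lt continuous_const Complex.continuous_re).mem_nhds h0] with y hy
      exact D.A_eq_A₂ hF ha hy
    refine DifferentiableAt.congr_of_eventuallyEq ?_ this
    unfold A₂
    rw [D.h_eq_lineInv hF]
    have hq : DifferentiableAt ℂ (fun s : ℂ => 1 / (s ^ 2 + (a : ℂ) ^ 2)) z :=
      DifferentiableAt.div (by fun_prop) (by fun_prop) (sq_add_sq_ne_zero a h0)
    exact hq.sub ((hFd.div_const _).mul (hd.differentiableAt_integral_Ici D.half_mem h0))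

lemma differentiable_dslope_of_differentiable {f : ℂ → ℂ} (hf : Differentiable ℂ f) (c : ℂ) :
    Differentiable ℂ (dslope f c) :=
  differentiableOn_univ.1 ((Complex.differentiableOn_dslope univ_mem).2 hf.differentiableOn)

lemma differentiable_MPlus (D : EvenQuotient E τ) (hF : ∀ z, F z = z ^ 2 * E z) (ha : 0 < a) :
    Differentiable ℂ (MPlus F τ a) := by
  have h1 := differentiable_dslope_of_differentiable (D.differentiable_F hF) 0
  have h2 := differentiable_dslope_of_differentiable h1 0
  exact ((D.differentiable_A hF ha).add (h1.const_mul _)).add (h2.const_mul _)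

lemma dslope_F (D : EvenQuotient E τ) (hF : ∀ z, F z = z ^ 2 * E z) (z : ℂ) :
    dslope F 0 z = z * E z := by
  rcases eq_or_ne z 0 with rfl | hz
  · have h1 := (D.differentiable 0).hasDerivAt
    have h2 := (hasDerivAt_pow 2 (0 : ℂ)).mul h1
    rw [dslope_same, funext hF]
    rw [zero_mul]
    refine h2.deriv.trans ?_
    simp
  · rw [dslope_of_ne _ hz, slope_def_field, hF, hF]
    field_simp
    ring

lemma dslope_dslope_F (D : EvenQuotient E τ) (hF : ∀ z, F z = z ^ 2 * E z) {z : ℂ} (hz : z ≠ 0) :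
    dslope (dslope F 0) 0 z = E z := by
  rw [dslope_of_ne _ hz, slope_def_field, D.dslope_F hF, D.dslope_F hF]
  field_simp
  ring

end EvenQuotient

/-! ### The sign of `F (M⁺ - t_a)` on the real axis. -/

lemma integrableOn_Iic_affine_mul_exp (p q : ℝ) {y : ℝ} (hy : 0 < y) :
    IntegrableOn (fun w => (p + q * w) * Real.exp (y * w)) (Iic 0) ∧
    ∫ w in Iic (0 : ℝ), (p + q * w) * Real.exp (y * w) = p / y - q / y ^ 2 := by
  have hs : 0 < ((y : ℂ)).re := by simpa using hy
  have hexp : ∀ v : ℝ, Complex.exp (-(y : ℂ) * v) = (Real.exp (-(y * v)) : ℂ) := fun v => by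
    push_cast; congr 1; ring
  have h1 := integrableOn_exp_neg_mul hs
  have h2 := integrableOn_id_mul_exp hs
  have h3 := integral_Ioi_exp_neg_mul hs
  have h4 := integral_Ioi_id_mul_exp hs
  simp only [hexp, ← Complex.ofReal_mul] at h1 h2 h3 h4
  rw [integral_complex_ofReal] at h3 h4
  have h1' : IntegrableOn (fun v => Real.exp (-(y * v))) (Ioi 0) := h1.re
  have h2' : IntegrableOn (fun v => v * Real.exp (-(y * v))) (Ioi 0) := h2.re
  have h3' : ∫ v in Ioi (0 : ℝ), Real.exp (-(y * v)) = 1 / y := by exact_mod_cast h3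
  have h4' : ∫ v in Ioi (0 : ℝ), v * Real.exp (-(y * v)) = 1 / y ^ 2 := by exact_mod_cast h4
  have e : (fun v : ℝ => p * Real.exp (-(y * v)) - q * (v * Real.exp (-(y * v)))) =
      fun v => (p + q * -v) * Real.exp (y * -v) := by
    ext v; rw [mul_neg y]; ring
  have hI : IntegrableOn (fun v => (p + q * -v) * Real.exp (y * -v)) (Ioi 0) := by
    rw [← e]; exact (h1'.const_mul p).sub (h2'.const_mul q)
  constructor
  · have hI' : IntegrableOn (fun v => (p + q * -v) * Real.exp (y * -v)) (Ici (-0)) := by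
      rwa [neg_zero, integrableOn_Ici_iff_integrableOn_Ioi]
    have h5 := hI'.comp_neg_Iic
    simpa only [neg_neg] using h5
  · have := integral_comp_neg_Ioi 0 fun w => (p + q * w) * Real.exp (y * w)
    rw [neg_zero] at this
    rw [← this, ← e, integral_sub (h1'.const_mul p) (h2'.const_mul q), integral_const_mul,
      integral_const_mul, h3', h4']
    ring

namespace EvenQuotient

variable {F E : ℂ → ℂ} {τ a : ℝ}

lemma interpolation_pos (D : EvenQuotient E τ) (hF : ∀ z, F z = z ^ 2 * E z) (ha : 0 < a) {x : ℝ}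
    (hx : 0 < x) : 0 ≤ F (x : ℂ) * (MPlus F τ a (x : ℂ) - (truncRecip a x : ℂ)) := by
  obtain ⟨K, hK⟩ := D.exists_density_le
  set H : ℝ → ℝ := fun w => ∫ u, density E u * ramp a (w - u) with hH
  have hh : ∀ w, h F τ a w = (H w : ℂ) := D.h_eq_ofReal hF ha
  have hint := (D.wellDefined hF ha).integrable_A₂ x (by simpa using hx)
  have hexp : ∀ w : ℝ, h F τ a w * Complex.exp (-(x : ℂ) * w) =
      ((H w * Real.exp (-(x * w)) : ℝ) : ℂ) := fun w => by
    rw [hh]; push_cast; congr 2; ring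
  simp only [hexp] at hint
  have hi : IntegrableOn (fun w => H w * Real.exp (-(x * w))) (Ioi 0) :=
    IntegrableOn.mono_set hint.re Ioi_subset_Ici_self
  have key := integral_ramp_sub_mul_exp_le ha D.half_mem.1 D.continuous_density D.density_neg
    D.density_nonneg hK D.integrable_density hx hi
  have hA : A F τ a x = 1 / ((x : ℂ) ^ 2 + (a : ℂ) ^ 2) -
      F x / a * ((∫ w in Ioi (0 : ℝ), H w * Real.exp (-(x * w)) : ℝ) : ℂ) := by
    rw [D.A_eq_A₂ hF ha (by simpa using hx), A₂]
    simp only [hexp]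
    rw [integral_complex_ofReal, integral_Ici_eq_integral_Ioi]
  have hx0 : (x : ℂ) ≠ 0 := by exact_mod_cast hx.ne'
  have ha0 : (a : ℂ) ≠ 0 := by exact_mod_cast ha.ne'
  have ht : (truncRecip a x : ℂ) = 1 / ((x : ℂ) ^ 2 + (a : ℂ) ^ 2) := by
    rw [truncRecip, if_pos hx.le]; push_cast; rw [one_div]
  -- `E` is real on the real axis, so `F(x)²` is a real square and the sign of `F(x)` plays no role.
  obtain ⟨e, hE⟩ : ∃ e : ℝ, E x = e := ⟨_, (D.ofReal_re x).symm⟩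
  have hval : F (x : ℂ) * (MPlus F τ a (x : ℂ) - (truncRecip a x : ℂ)) =
      (((x ^ 2 * e) ^ 2 / a * (H 0 / x + (∫ u, density E u) / (a * x ^ 2) -
        ∫ w in Ioi (0 : ℝ), H w * Real.exp (-(x * w))) : ℝ) : ℂ) := by
    rw [MPlus, hA, ht, D.dslope_F hF, D.dslope_dslope_F hF hx0, D.two_mul_deriv_g_zero hF, hh, hF,
      hE]
    push_cast
    field_simp
    ring
  rw [hval]
  refine Complex.zero_le_real.2 (mul_nonneg (by positivity) ?_)
  linarith

lemma interpolation_neg (D : EvenQuotient E τ) (hF : ∀ z, F z = z ^ 2 * E z) (ha : 0 < a) {x : ℝ}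
    (hx : x < 0) : 0 ≤ F (x : ℂ) * (MPlus F τ a (x : ℂ) - (truncRecip a x : ℂ)) := by
  obtain ⟨K, hK⟩ := D.exists_density_le
  have hxτ : x < τ := hx.trans D.τ_pos
  set H : ℝ → ℝ := fun w => ∫ u, density E u * ramp a (w - u) with hH
  have hh : ∀ w, h F τ a w = (H w : ℂ) := D.h_eq_ofReal hF ha
  have hint := (D.wellDefined hF ha).integrable_A₁ x (by simpa using hxτ)
  have hexp : ∀ w : ℝ, h F τ a w * Complex.exp (-(x : ℂ) * w) =
      ((H w * Real.exp (-x * w) : ℝ) : ℂ) := fun w => by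
    rw [hh]; push_cast; rfl
  simp only [hexp] at hint
  have hi : IntegrableOn (fun w => H w * Real.exp (-x * w)) (Iic 0) := hint.re
  obtain ⟨hi', hv⟩ := integrableOn_Iic_affine_mul_exp (H 0) ((∫ u, density E u) / a)
    (neg_pos.2 hx)
  -- The left side is the integral over `w ≤ 0` of the affine minorant of `H` against `e^{-xw}`.
  have key : H 0 / -x - (∫ u, density E u) / a / (-x) ^ 2 ≤
      ∫ w in Iic (0 : ℝ), H w * Real.exp (-x * w) := by
    rw [← hv]
    refine setIntegral_mono_on hi' hi measurableSet_Iic fun w hw => ?_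
    exact mul_le_mul_of_nonneg_right (le_integral_ramp_sub ha D.half_mem.1 D.continuous_density
      D.density_neg D.density_nonneg hK D.integrable_density hw) (Real.exp_nonneg _)
  have hA : A F τ a x =
      F x / a * ((∫ w in Iic (0 : ℝ), H w * Real.exp (-x * w) : ℝ) : ℂ) := by
    rw [A, if_pos (by simpa using hxτ), A₁]
    simp only [hexp]
    rw [integral_complex_ofReal]
  have hx0 : (x : ℂ) ≠ 0 := by exact_mod_cast hx.ne
  have ha0 : (a : ℂ) ≠ 0 := by exact_mod_cast ha.ne'
  have ht : (truncRecip a x : ℂ) = 0 := by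
    rw [truncRecip, if_neg (not_le.2 hx), Complex.ofReal_zero]
  obtain ⟨e, hE⟩ : ∃ e : ℝ, E x = e := ⟨_, (D.ofReal_re x).symm⟩
  have hval : F (x : ℂ) * (MPlus F τ a (x : ℂ) - (truncRecip a x : ℂ)) =
      (((x ^ 2 * e) ^ 2 / a * ((∫ w in Iic (0 : ℝ), H w * Real.exp (-x * w)) -
        (H 0 / -x - (∫ u, density E u) / a / (-x) ^ 2)) : ℝ) : ℂ) := by
    rw [MPlus, hA, ht, D.dslope_F hF, D.dslope_dslope_F hF hx0, D.two_mul_deriv_g_zero hF, hh, hF,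
      hE]
    push_cast
    field_simp
    ring
  rw [hval]
  exact Complex.zero_le_real.2 (mul_nonneg (by positivity) (sub_nonneg.2 key))

end EvenQuotient

end LPInterp


/-- Order relations between complex numbers are those of `ComplexOrder`: `z ≤ w` means
`z.re ≤ w.re` and `z.im = w.im`, so that `0 ≤ z` says that `z` is real and nonnegative. -/
theorem mainTheorem4 (F : ℂ → ℂ) (a τ : ℝ) (ha : 0 < a)
    (hLP : LPInterp.LaguerrePolya F)
    (heven : ∀ z : ℂ, F (-z) = F z)
    (hzero : analyticOrderAt F 0 = 2)
    (hτ : 0 < τ) (hFτ : F (τ : ℂ) = 0)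
    (hpos : ∀ x : ℝ, 0 < x → x < τ → 0 < F (x : ℂ))
    (hia : F (Complex.I * (a : ℂ)) < 0) :
    LPInterp.WellDefined F τ a ∧
    Differentiable ℂ (LPInterp.MPlus F τ a) ∧
    ∀ x : ℝ, 0 ≤ F (x : ℂ) *
      (LPInterp.MPlus F τ a (x : ℂ) - (LPInterp.truncRecip a x : ℂ)) := by
  obtain ⟨E, hF, ⟨D⟩⟩ := LPInterp.exists_evenQuotient hLP heven hzero hτ hFτ hpos
  refine ⟨D.wellDefined hF ha, D.differentiable_MPlus hF ha, fun x => ?_⟩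
  rcases lt_trichotomy x 0 with hx | rfl | hx
  · exact D.interpolation_neg hF ha hx
  -- At the origin the factor `F 0` vanishes.
  · simp [hF]
  · exact D.interpolation_pos hF ha hx
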